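/- Let $N\ge 2$, and let $\mathcal G_p$ (physical) and $\mathcal G_c$ (cyber) be undirected weighted graphs on the nodes $\{1,\dots,N\}$ with symmetric non-negative weights $a_{ij}$, $b_{ij}$ (zero on the diagonal, positive exactly on the edges) and Laplacian matrices $\mathcal L_p$, $\mathcal L_c$, where $\mathcal G_c$ is connected. Let $A,A_p\in\mathbb R^{n\times n}$ and $B\in\mathbb R^{n\times 1}$. For $K\in\mathbb R^{1\times n}$ consider the closed-loop system $$x_i^+=Ax_i+A_p\sum_{j}a_{ij}(x_j-x_i)+Bu_i,\qquad u_i=K\sum_{j}b_{ij}(x_i-x_j),\qquad i=1,\dots,N,$$ with $x_i(t)\in\mathbb R^n$. The gain $K$ is said to achieve consensus if, for all initial states, $x_i(t)-\frac1N\sum_{j}x_j(t)\to 0$ as $t\to\infty$, for every $i$. Let $\lambda_{p,2},\dots,\lambda_{p,N}$ and $\lambda_{c,2},\dots,\lambda_{c,N}$ be the eigenvalues of $\mathcal L_p$ and $\mathcal L_c$ restricted to the space of vectors in $\mathbb R^N$ with zero average. Assume that $\mathcal L_p$ and $\mathcal L_c$ commute, that $(A-\lambda_{p,i}A_p,B)$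 is controllable for all $i\in\{2,\dots,N\}$, and that $A_p=\alpha A$ with $\alpha\in\mathbb R$. Set $\alpha_i=1-\alpha\lambda_{p,i}$, $\alpha_{\max}=\max_i|\alpha_i|$, $\alpha_{\min}=\min_i|\alpha_i|$, $\lambda_{c,\max}=\max_j\lambda_{c,j}$, $\bar A=\alpha_{\max}A$ and $$\sigma_c=1-\frac{1}{\prod_k|\lambda^u_k(\bar A)|^2},$$ where $\lambda_k^u(\bar A)$ are the unstable eigenvalues of $\bar A$ (those of modulus at least $1$), counted with algebraic multiplicity, and an empty product is $1$. All minima and maxima below are over $i,j\in\{2,\dots,N\}$ independently. 1. If $\bar A$ is Schur stable (all its eigenvalues have modulus less than $1$), then $K=0$ achieves consensus. 2. If $\bar A$ is not Schur stable and $$\left(\frac{\max_{i,j}\frac{\alpha_i}{\lambda_{c,j}}-\min_{i,j}\frac{\alpha_i}{\lambda_{c,j}}}{2}\right)^2<\frac{\alpha_{\min}^2-\alpha_{\max}^2\sigma_c}{\lambda_{c,\max}^2},$$ put $$k^*=\frac{\min_{i,j}\frac{\alpha_i}{\lambda_{c,j}}+\max_{i,j}\frac{\alpha_i}{\lambda_{c,j}}}{2},\qquad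 \sigma=\min_{i,j}\frac{2\alpha_i\lambda_{c,j}k^*-\lambda_{c,j}^2(k^*)^2}{\alpha_{\max}^2}.$$ Then $\sigma>\sigma_c$; there is a matrix $P=P^\top\succ0$ with $$\bar A^\top P\bar A-\sigma\,\bar A^\top PB(B^\top PB)^{-1}B^\top P\bar A-P\prec0;$$ and for every such $P$ the gain $K=-k^*(B^\top PB)^{-1}B^\top PA$ achieves consensus. -/

import Mathlib

open Filter Topology Matrix

namespace LIMAS

noncomputable section

/-- An undirected weighted graph on the nodes `Fin N`, given by its adjacency matrix `[a_ij]`: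
symmetric, non-negative, with zero diagonal. The pair `(i, j)` is an edge exactly when
`a_ij > 0`. -/
structure WeightedGraph (N : ℕ) where
  weight : Matrix (Fin N) (Fin N) ℝ
  symm : ∀ i j, weight i j = weight j i
  nonneg : ∀ i j, 0 ≤ weight i j
  loopless : ∀ i, weight i i = 0

/-- The underlying undirected graph (edges are the pairs of positive weight). -/
def WeightedGraph.graph {N : ℕ} (G : WeightedGraph N) : SimpleGraph (Fin N) where
  Adj i j := 0 < G.weight i j
  symm := ⟨fun i j h => by rw [G.symm j i]; exact h⟩
  loopless := ⟨fun i h => by simp [G.loopless i] at h⟩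

/-- The Laplacian matrix: degree matrix minus adjacency matrix. -/
def WeightedGraph.laplacian {N : ℕ} (G : WeightedGraph N) : Matrix (Fin N) (Fin N) ℝ :=
  Matrix.diagonal (fun i => ∑ j, G.weight i j) - G.weight

/-- `x` is a closed-loop trajectory of the interconnected system
`x_i⁺ = A x_i + A_p ∑_j a_ij (x_j - x_i) + B u_i` with the distributed control
`u_i = K ∑_j b_ij (x_i - x_j)`, where `a_ij`, `b_ij` are the weights of the physical graph `Gp`
and of the cyber graph `Gc`. Non-neighbours have weight zero, so that the sums over the
neighbours are sums over all nodes. -/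
def IsTrajectory {N n : ℕ} (Gp Gc : WeightedGraph N) (A Ap : Matrix (Fin n) (Fin n) ℝ)
    (B : Matrix (Fin n) (Fin 1) ℝ) (K : Matrix (Fin 1) (Fin n) ℝ)
    (x : ℕ → Fin N → Fin n → ℝ) : Prop :=
  ∀ t i, x (t + 1) i =
    A *ᵥ x t i + Ap *ᵥ (∑ j, Gp.weight i j • (x t j - x t i))
      + B *ᵥ (K *ᵥ (∑ j, Gc.weight i j • (x t i - x t j)))

/-- The average `(1/N) ∑_i x_i` of the states of the subsystems. -/
def average {N n : ℕ} (x : Fin N → Fin n → ℝ) : Fin n → ℝ :=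
  (N : ℝ)⁻¹ • ∑ i, x i

/-- The gain `K` achieves consensus: along every closed-loop trajectory, the deviation of the
state of each subsystem from the average state tends to zero. -/
def AchievesConsensus {N n : ℕ} (Gp Gc : WeightedGraph N) (A Ap : Matrix (Fin n) (Fin n) ℝ)
    (B : Matrix (Fin n) (Fin 1) ℝ) (K : Matrix (Fin 1) (Fin n) ℝ) : Prop :=
  ∀ x : ℕ → Fin N → Fin n → ℝ, IsTrajectory Gp Gc A Ap B K x →
    ∀ i, Tendsto (fun t => x t i - average (x t)) atTop (𝓝 0)

/-- The pair `(A, B)` is controllable: `[B, A B, …, A^(n-1) B]` has rank `n`. -/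
def Controllable {n m : ℕ} (A : Matrix (Fin n) (Fin n) ℝ) (B : Matrix (Fin n) (Fin m) ℝ) :
    Prop :=
  (Matrix.of fun (i : Fin n) (p : Fin n × Fin m) => (A ^ (p.1 : ℕ) * B) i p.2).rank = n

/-- All complex eigenvalues of `M` lie in the open unit disk. -/
def SchurStable {n : ℕ} (M : Matrix (Fin n) (Fin n) ℝ) : Prop :=
  ∀ z ∈ spectrum ℂ (M.map (algebraMap ℝ ℂ)), ‖z‖ < 1

/-- `σ_c = 1 - 1 / ∏ |λ|²`, the product being over the unstable complex eigenvalues of `M`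
(those with `|λ| ≥ 1`), repeated according to their algebraic multiplicity. -/
def sigmaC {n : ℕ} (M : Matrix (Fin n) (Fin n) ℝ) : ℝ :=
  1 - 1 / (((M.map (algebraMap ℝ ℂ)).charpoly.roots.filter (fun z => 1 ≤ ‖z‖)).map
    (fun z => ‖z‖ ^ 2)).prod

/-- `P = Pᵀ ≻ 0` solves
`Mᵀ P M - σ Mᵀ P B (Bᵀ P B)⁻¹ Bᵀ P M - P ≺ 0`. -/
def IsMARESolution {n : ℕ} (M : Matrix (Fin n) (Fin n) ℝ) (B : Matrix (Fin n) (Fin 1) ℝ)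
    (σ : ℝ) (P : Matrix (Fin n) (Fin n) ℝ) : Prop :=
  P.PosDef ∧
    (-(Mᵀ * P * M - σ • (Mᵀ * P * B * (Bᵀ * P * B)⁻¹ * Bᵀ * P * M) - P)).PosDef

/-- The set `{λ_2, …, λ_N}` of eigenvalues of a Laplacian `L` on the subspace of vectors with
zero average, i.e. its eigenvalues once the eigenvalue `0` of the all-ones vector is removed. -/
def reducedEigenvalues {N : ℕ} (L : Matrix (Fin N) (Fin N) ℝ) : Set ℝ :=
  {μ | ∃ v : Fin N → ℝ, v ≠ 0 ∧ ∑ i, v i = 0 ∧ L *ᵥ v = μ • v}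

/-- The set of the numbers `α_i = 1 - α λ_{p,i}`, `i = 2, …, N`. -/
def alphas {N : ℕ} (Gp : WeightedGraph N) (α : ℝ) : Set ℝ :=
  (fun μ => 1 - α * μ) '' reducedEigenvalues Gp.laplacian

/-- `α_max = max_i |α_i|`. -/
def alphaMax {N : ℕ} (Gp : WeightedGraph N) (α : ℝ) : ℝ :=
  sSup ((fun a => |a|) '' alphas Gp α)

/-- `α_min = min_i |α_i|`. -/
def alphaMin {N : ℕ} (Gp : WeightedGraph N) (α : ℝ) : ℝ :=
  sInf ((fun a => |a|) '' alphas Gp α)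

/-- `λ_{c,max} = max_j λ_{c,j}`. -/
def lambdaCMax {N : ℕ} (Gc : WeightedGraph N) : ℝ :=
  sSup (reducedEigenvalues Gc.laplacian)

/-- The set of all ratios `α_i / λ_{c,j}`, with `i` and `j` independent. -/
def ratios {N : ℕ} (Gp Gc : WeightedGraph N) (α : ℝ) : Set ℝ :=
  Set.image2 (fun a l => a / l) (alphas Gp α) (reducedEigenvalues Gc.laplacian)

/-- `k* = (min_{i,j} α_i / λ_{c,j} + max_{i,j} α_i / λ_{c,j}) / 2`. -/
def kStar {N : ℕ} (Gp Gc : WeightedGraph N) (α : ℝ) : ℝ :=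
  (sInf (ratios Gp Gc α) + sSup (ratios Gp Gc α)) / 2

/-- `σ = min_{i,j} (2 α_i λ_{c,j} k* - λ_{c,j}² k*²) / α_max²`. -/
def sigmaStar {N : ℕ} (Gp Gc : WeightedGraph N) (α : ℝ) : ℝ :=
  sInf (Set.image2
    (fun a l => (2 * a * l * kStar Gp Gc α - l ^ 2 * kStar Gp Gc α ^ 2) / alphaMax Gp α ^ 2)
    (alphas Gp α) (reducedEigenvalues Gc.laplacian))

end

end LIMAS

/-!
Commuting Laplacians have a common eigenbasis. A common eigenvector with eigenvalues `μ` of `L_p`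
and `l` of `L_c` turns the network into the single loop `z⁺ = (A - μ A_p + l B K) z`. Since the
cyber graph is connected, a common eigenvector is constant or has zero average, so consensus means
that all loops of the second kind are stable (`LIMAS.achievesConsensus_of_modes`). With `A_p = α A`
the loop matrix is `a A + l B K`, `a = 1 - α μ`, and `|a| ≤ α_max`.

If `α_max A` is Schur stable, so is every `a A`, and `K = 0` suffices. Otherwise, with the gain
`K = -k (Bᵀ P B)⁻¹ Bᵀ P A`, expanding `P - Mᵀ P M` for the loop matrix `M` shows that `P` is a
Lyapunov matrix for all loops simultaneously (`LIMAS.IsMARESolution.lyapunov`). That `σ > σ_c` comes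
from `2 a l k - l² k² = a² - l² (a / l - k)²`, where `k` is the midpoint of the ratios `a / l`.

The core is the solvability of the modified Riccati inequality for every `σ > σ_c`
(`LIMAS.Controllable.exists_isMARESolution`). Completing the square shows that a feedback `F` and a
matrix `P` with `(A + B F)ᵀ P (A + B F) + Fᵀ F ≺ P` and `(1 - σ) (1 + Bᵀ P B) ≤ 1` are enough, so
one needs a stabilizing feedback of small energy. With no eigenvalue of `A` on the unit circle,
`1 + Bᵀ P B` can be as close as desired to the product of the `|λ|²` over the unstable eigenvalues
`λ` of `A`, by an explicit construction over `ℂ`: starting from `P = 0`,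
`F = 0`, rank-one corrections along left eigenvectors reflect the unstable
eigenvalues one at a time into the unit disk, `λ ↦ 1 / conj λ`, and each multiplies
`1 + B* P B` by `|λ|²` (`IsEnergyFeedback.reflect`); controllability keeps the left eigenvectors
from being orthogonal to `B`. The result is real because a stabilizing minimum-energy feedback is
unique (`IsEnergyFeedback.unique`). Eigenvalues on the unit circle are avoided by treating `r A`
with `r > 1` close to `1`, and a small multiple of a Lyapunov matrix of the closed loop makes `P`
definite and the inequality strict.
-/

/-! ### Schur stability and Lyapunov matrices -/

section Stability

/-- A consequence of Gelfand's formula: the powers decay geometrically. -/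
theorem tendsto_pow_zero_of_spectrum {n : ℕ} (M : Matrix (Fin n) (Fin n) ℂ)
    (h : ∀ z ∈ spectrum ℂ M, ‖z‖ < 1) : Tendsto (fun k : ℕ => M ^ k) atTop (𝓝 0) := by
  let _ := Matrix.linftyOpNormedRing (n := Fin n) (α := ℂ)
  let _ := Matrix.linftyOpNormedAlgebra (n := Fin n) (R := ℂ) (α := ℂ)
  rcases subsingleton_or_nontrivial (Matrix (Fin n) (Fin n) ℂ) with hs | hn
  · exact tendsto_const_nhds.congr fun k => Subsingleton.elim _ _
  have hr : spectralRadius ℂ M < (1 : NNReal) :=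
    spectrum.spectralRadius_lt_of_forall_lt M fun z hz => by
      rw [← NNReal.coe_lt_coe]; simpa using h z hz
  have hlim := spectrum.pow_nnnorm_pow_one_div_tendsto_nhds_spectralRadius M
  obtain ⟨q, hq1, hq2⟩ := ENNReal.lt_iff_exists_nnreal_btwn.1 hr
  have hq2' : q < 1 := by exact_mod_cast hq2
  have hev : ∀ᶠ k : ℕ in atTop, ‖M ^ k‖ ≤ (q : ℝ) ^ k := by
    filter_upwards [hlim.eventually_lt_const hq1, eventually_ge_atTop 1] with k hk hk1
    have hk0 : (k : ℝ) ≠ 0 := by positivity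
    have h1 := ENNReal.rpow_le_rpow hk.le (z := (k : ℝ)) (by positivity)
    rw [← ENNReal.rpow_mul, one_div_mul_cancel hk0, ENNReal.rpow_one, ENNReal.rpow_natCast] at h1
    exact_mod_cast h1
  refine squeeze_zero_norm' hev ?_
  exact tendsto_pow_atTop_nhds_zero_of_lt_one q.2 (by exact_mod_cast hq2')

theorem LIMAS.SchurStable.tendsto_pow {n : ℕ} {M : Matrix (Fin n) (Fin n) ℝ}
    (h : LIMAS.SchurStable M) : Tendsto (fun k : ℕ => M ^ k) atTop (𝓝 0) := by
  have h1 := tendsto_pow_zero_of_spectrum _ h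
  have h2 : Tendsto (fun k : ℕ => ((M.map (algebraMap ℝ ℂ)) ^ k).map Complex.re) atTop
      (𝓝 ((0 : Matrix (Fin n) (Fin n) ℂ).map Complex.re)) :=
    ((continuous_id.matrix_map Complex.continuous_re).tendsto 0).comp h1
  have h3 : (0 : Matrix (Fin n) (Fin n) ℂ).map Complex.re = 0 := by ext; simp
  rw [h3] at h2
  refine h2.congr fun k => ?_
  rw [← Matrix.map_pow]
  ext; simp

theorem LIMAS.SchurStable.zero {n : ℕ} : LIMAS.SchurStable (0 : Matrix (Fin n) (Fin n) ℝ) := by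
  intro z hz
  have h0 : (0 : Matrix (Fin n) (Fin n) ℝ).map (algebraMap ℝ ℂ) = 0 := by ext; simp
  rw [h0] at hz
  rcases subsingleton_or_nontrivial (Matrix (Fin n) (Fin n) ℂ) with hs | hn
  · simp at hz
  · rw [spectrum.zero_eq] at hz
    have : z = 0 := by simpa using hz
    simp [this]

theorem LIMAS.SchurStable.smul_of_abs_le {n : ℕ} {A : Matrix (Fin n) (Fin n) ℝ} {a b : ℝ}
    (hab : |a| ≤ b) (h : LIMAS.SchurStable (b • A)) : LIMAS.SchurStable (a • A) := by
  intro z hz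
  rcases eq_or_ne b 0 with rfl | hb
  · have : a = 0 := by simpa using hab
    exact h z (by rwa [this] at hz)
  have hb0 : 0 < b := lt_of_le_of_ne ((abs_nonneg a).trans hab) hb.symm
  rcases eq_or_ne a 0 with rfl | ha
  · exact LIMAS.SchurStable.zero z (by rwa [zero_smul] at hz)
  have e : ∀ c : ℝ, (c • A).map (algebraMap ℝ ℂ) = (c : ℂ) • A.map (algebraMap ℝ ℂ) := by
    intro c; ext; simp
  have ha' : (a : ℂ) ≠ 0 := by exact_mod_cast ha
  have hb' : (b : ℂ) ≠ 0 := by exact_mod_cast hb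
  have h2 : (b / a : ℂ) * z ∈ spectrum ℂ ((b • A).map (algebraMap ℝ ℂ)) := by
    have := spectrum.smul_mem_smul_iff (R := ℂ) (s := z) (a := (a • A).map (algebraMap ℝ ℂ))
      (r := Units.mk0 (b / a : ℂ) (div_ne_zero hb' ha'))
    have := this.2 hz
    rw [e] at this
    rw [e]
    simpa only [Units.smul_def, Units.val_mk0, smul_smul, smul_eq_mul,
      div_mul_cancel₀ _ ha'] using this
  have h3 := h _ h2
  rw [norm_mul, norm_div, Complex.norm_real, Complex.norm_real, Real.norm_eq_abs, Real.norm_eq_abs,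
    abs_of_pos hb0] at h3
  have : 1 ≤ b / |a| := by rwa [one_le_div (abs_pos.2 ha)]
  nlinarith [norm_nonneg z]

open scoped MatrixOrder in
/-- Lyapunov's criterion: a quadratic form that strictly decreases along a linear recursion forces
every trajectory to zero. The decrements are summable since the form is bounded below. -/
theorem tendsto_zero_of_lyapunov {n : ℕ} {P M : Matrix (Fin n) (Fin n) ℝ} (hP : P.PosDef)
    (hQ : (P - Mᵀ * P * M).PosDef) {z : ℕ → Fin n → ℝ} (hz : ∀ t, z (t + 1) = M *ᵥ z t) :
    Tendsto z atTop (𝓝 0) := by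
  set Q := P - Mᵀ * P * M with hQdef
  set V : ℕ → ℝ := fun t => z t ⬝ᵥ P *ᵥ z t with hV
  have hstep : ∀ t, z t ⬝ᵥ Q *ᵥ z t = V t - V (t + 1) := by
    intro t
    simp only [hV, hz, hQdef, Matrix.sub_mulVec, dotProduct_sub, ← Matrix.mulVec_mulVec]
    rw [Matrix.dotProduct_mulVec _ Mᵀ, Matrix.vecMul_transpose]
  have hV0 : ∀ t, 0 ≤ V t := fun t => by simpa using hP.posSemidef.dotProduct_mulVec_nonneg (z t)
  have hQ0 : ∀ t, 0 ≤ z t ⬝ᵥ Q *ᵥ z t :=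
    fun t => by simpa using hQ.posSemidef.dotProduct_mulVec_nonneg (z t)
  have hsum : Summable fun t => z t ⬝ᵥ Q *ᵥ z t := by
    refine summable_of_sum_range_le (c := V 0) hQ0 fun k => ?_
    simp only [hstep]
    rw [Finset.sum_range_sub']
    linarith [hV0 k]
  obtain ⟨C, hC⟩ : ∃ C : Matrix (Fin n) (Fin n) ℝ, IsUnit C ∧ Q = Cᵀ * C := by
    have h1 : CFC.sqrt Q * CFC.sqrt Q = Q :=
      CFC.sqrt_mul_sqrt_self Q (Matrix.nonneg_iff_posSemidef.2 hQ.posSemidef)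
    have h2 : (CFC.sqrt Q)ᵀ = CFC.sqrt Q := by
      have := (Matrix.nonneg_iff_posSemidef.1 (CFC.sqrt_nonneg Q)).isHermitian
      simpa [Matrix.IsHermitian] using this
    refine ⟨CFC.sqrt Q, ?_, by rw [h2, h1]⟩
    have h3 : IsUnit (CFC.sqrt Q * CFC.sqrt Q) := by rw [h1]; exact hQ.isUnit
    exact isUnit_of_mul_isUnit_left h3
  obtain ⟨hCu, hCQ⟩ := hC
  have h0 := hsum.tendsto_atTop_zero
  have hCz : Tendsto (fun t => C *ᵥ z t) atTop (𝓝 0) := by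
    rw [tendsto_pi_nhds]
    intro i
    have : ∀ t, ((C *ᵥ z t) i) ^ 2 ≤ z t ⬝ᵥ Q *ᵥ z t := by
      intro t
      rw [hCQ, ← Matrix.mulVec_mulVec, Matrix.dotProduct_mulVec _ Cᵀ, Matrix.vecMul_transpose,
        dotProduct]
      simp only [← pow_two]
      exact Finset.single_le_sum (f := fun i => ((C *ᵥ z t) i) ^ 2)
        (fun j _ => sq_nonneg _) (Finset.mem_univ i)
    have h2 := squeeze_zero (fun t => sq_nonneg _) this h0
    have h3 := (Real.continuous_sqrt.tendsto 0).comp h2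
    simp only [Real.sqrt_zero, Function.comp_def, Real.sqrt_sq_eq_abs] at h3
    exact (tendsto_zero_iff_abs_tendsto_zero _).2 h3
  have := (((Continuous.matrix_mulVec continuous_const continuous_id :
    Continuous fun v : Fin n → ℝ => C⁻¹ *ᵥ v)).tendsto 0).comp hCz
  simp only [Matrix.mulVec_zero] at this
  refine this.congr fun t => ?_
  simp [Matrix.mulVec_mulVec, Matrix.nonsing_inv_mul _ ((Matrix.isUnit_iff_isUnit_det _).1 hCu)]

open scoped Matrix.Norms.L2Operator in
/-- Once `‖M ^ m‖ < 1`, the finite sum of `(M ^ k)ᵀ M ^ k` over `k < m` is a Lyapunov matrix: the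
Lyapunov difference telescopes to `1 - (M ^ m)ᵀ M ^ m`. -/
theorem LIMAS.SchurStable.exists_lyapunov {n : ℕ} {M : Matrix (Fin n) (Fin n) ℝ}
    (h : LIMAS.SchurStable M) :
    ∃ W : Matrix (Fin n) (Fin n) ℝ, W.PosDef ∧ (W - Mᵀ * W * M).PosDef := by
  obtain ⟨m, hm1, hm⟩ : ∃ m : ℕ, 1 ≤ m ∧ (1 - (M ^ m)ᵀ * M ^ m).PosDef := by
    have h0 := h.tendsto_pow
    have h1 : Tendsto (fun k : ℕ => ‖M ^ k‖) atTop (𝓝 0) := by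
      simpa using h0.norm
    obtain ⟨m, hm, hm1⟩ := ((h1.eventually_lt_const one_pos).and (eventually_ge_atTop 1)).exists
    refine ⟨m, hm1, Matrix.PosDef.of_dotProduct_mulVec_pos ?_ fun x hx => ?_⟩
    · exact Matrix.isHermitian_one.sub (by
        simpa using Matrix.isHermitian_conjTranspose_mul_self (M ^ m))
    · have h2 := Matrix.l2_opNorm_mulVec (M ^ m) (WithLp.toLp 2 x)
      have h3 : 0 < ‖WithLp.toLp 2 x‖ := by simpa using hx
      have h4 : ‖WithLp.toLp 2 (M ^ m *ᵥ x)‖ < ‖WithLp.toLp 2 x‖ :=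
        h2.trans_lt (by simpa using mul_lt_mul_of_pos_right hm h3)
      have h5 : ∀ y : Fin n → ℝ, y ⬝ᵥ y = ‖WithLp.toLp 2 y‖ ^ 2 := by
        intro y
        rw [EuclideanSpace.norm_sq_eq]
        simp [dotProduct, pow_two]
      have h6 : star x ⬝ᵥ (1 - (M ^ m)ᵀ * M ^ m) *ᵥ x =
          x ⬝ᵥ x - (M ^ m *ᵥ x) ⬝ᵥ (M ^ m *ᵥ x) := by
        rw [Matrix.sub_mulVec, dotProduct_sub, ← Matrix.mulVec_mulVec, Matrix.dotProduct_mulVec _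
          (M ^ m)ᵀ, Matrix.vecMul_transpose]
        simp
      rw [h6, h5, h5]
      have := norm_nonneg (WithLp.toLp 2 (M ^ m *ᵥ x))
      nlinarith
  refine ⟨∑ k ∈ Finset.range m, (M ^ k)ᵀ * M ^ k, ?_, ?_⟩
  · obtain ⟨m, rfl⟩ := Nat.exists_eq_add_of_le' hm1
    rw [Finset.sum_range_succ']
    refine Matrix.PosDef.posSemidef_add (Matrix.posSemidef_sum _ fun k _ => ?_) ?_
    · simpa using Matrix.posSemidef_conjTranspose_mul_self (M ^ (k + 1))
    · simpa using Matrix.PosDef.one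
  · have : ∑ k ∈ Finset.range m, (M ^ k)ᵀ * M ^ k -
        Mᵀ * (∑ k ∈ Finset.range m, (M ^ k)ᵀ * M ^ k) * M = 1 - (M ^ m)ᵀ * M ^ m := by
      rw [Finset.mul_sum, Finset.sum_mul, ← Finset.sum_sub_distrib]
      have e : ∀ k, Mᵀ * ((M ^ k)ᵀ * M ^ k) * M = (M ^ (k + 1))ᵀ * M ^ (k + 1) := by
        intro k
        conv_rhs => rw [pow_succ, Matrix.transpose_mul]
        simp only [Matrix.mul_assoc]
      simp only [e]
      rw [Finset.sum_range_sub']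
      simp
    rwa [this]

end Stability

/-! ### Minimum-energy stabilization by reflecting eigenvalues -/

section Deflation

open scoped ComplexOrder

/-- Replacing `C` by `C - g B W`, where `W` is a left eigenvector of `C`, moves the eigenvalue
`lam` of `W` to `lam - g (W B)` and leaves the others in place. -/
theorem charpoly_sub_mul_leftEigenvector {n : ℕ} {C : Matrix (Fin n) (Fin n) ℂ}
    {B : Matrix (Fin n) (Fin 1) ℂ} {W : Matrix (Fin 1) (Fin n) ℂ} {lam β : ℂ}
    (hW : W * C = lam • W) (hβ : W * B = β • 1) (g : ℂ) :
    (Polynomial.X - Polynomial.C lam) * (C - g • (B * W)).charpoly =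
      (Polynomial.X - Polynomial.C (lam - g * β)) * C.charpoly := by
  refine Polynomial.eq_of_infinite_eval_eq _ _ (Set.Infinite.mono (s := {lam}ᶜ) ?_
    (Set.finite_singleton lam).infinite_compl)
  intro z hz
  have hz' : z - lam ≠ 0 := sub_ne_zero.2 hz
  have key : Matrix.scalar (Fin n) z - (C - g • (B * W)) =
      (1 + ((g / (z - lam)) • B) * W) * (Matrix.scalar (Fin n) z - C) := by
    have h1 : W * (Matrix.scalar (Fin n) z - C) = (z - lam) • W := by
      rw [Matrix.mul_sub, hW, sub_smul]
      congr 1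
      ext; simp [mul_comm]
    rw [Matrix.add_mul, Matrix.mul_assoc, h1, Matrix.one_mul, Matrix.smul_mul, Matrix.mul_smul,
      smul_smul, div_mul_cancel₀ _ hz']
    abel
  have hdet : (1 + ((g / (z - lam)) • B) * W).det = 1 + g / (z - lam) * β := by
    rw [Matrix.det_one_add_mul_comm, Matrix.mul_smul, hβ]
    simp
  simp only [Set.mem_ofPred_eq, Polynomial.eval_mul, Polynomial.eval_sub, Polynomial.eval_X,
    Polynomial.eval_C, Matrix.eval_charpoly]
  rw [key, Matrix.det_mul, hdet]
  field_simp
  ring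

/-- `F` is a minimum-energy feedback of `x⁺ = A x + B u` with value matrix `X`, the solution of the
Riccati equation for the cost `∑ ‖u‖²`. Along the closed loop, the energy spent plus the terminal
cost `x* X x` is constant (`lyapunov`), and `F` is optimal for that terminal cost (`optimal`).
Stability of the closed loop is not part of the definition. The real number `R` is `1 + B* X B`. -/
structure IsEnergyFeedback {n : ℕ} (A : Matrix (Fin n) (Fin n) ℂ) (B : Matrix (Fin n) (Fin 1) ℂ)
    (X : Matrix (Fin n) (Fin n) ℂ) (F : Matrix (Fin 1) (Fin n) ℂ) (R : ℝ) : Prop where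
  posSemidef : X.PosSemidef
  optimal : Bᴴ * (X * (A + B * F)) = -F
  lyapunov : (A + B * F)ᴴ * (X * (A + B * F)) + Fᴴ * F = X
  gram : Bᴴ * (X * B) = ((R : ℂ) - 1) • 1
  pos : 0 < R

theorem isEnergyFeedback_zero {n : ℕ} (A : Matrix (Fin n) (Fin n) ℂ)
    (B : Matrix (Fin n) (Fin 1) ℂ) : IsEnergyFeedback A B 0 0 1 where
  posSemidef := Matrix.PosSemidef.zero
  optimal := by simp
  lyapunov := by simp
  gram := by simp
  pos := one_pos

/-- One unstable closed-loop eigenvalue `lam` can be reflected to `1 / conj lam`, at the price of a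
factor `|lam|²` in `R`. -/
theorem IsEnergyFeedback.reflect {n : ℕ} {A : Matrix (Fin n) (Fin n) ℂ}
    {B : Matrix (Fin n) (Fin 1) ℂ} {X : Matrix (Fin n) (Fin n) ℂ} {F : Matrix (Fin 1) (Fin n) ℂ}
    {R : ℝ} (h : IsEnergyFeedback A B X F R) {W : Matrix (Fin 1) (Fin n) ℂ} {lam β : ℂ}
    (hlam : 1 < ‖lam‖) (hβ : β ≠ 0) (hW : W * (A + B * F) = lam • W) (hWB : W * B = β • 1) :
    ∃ X' F', IsEnergyFeedback A B X' F' (R * ‖lam‖ ^ 2) ∧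
      (Polynomial.X - Polynomial.C lam) * (A + B * F').charpoly =
        (Polynomial.X - Polynomial.C (star lam)⁻¹) * (A + B * F).charpoly := by
  have hl0 : lam ≠ 0 := by rintro rfl; simp at hlam; linarith
  have hsl0 : star lam ≠ 0 := by simpa using hl0
  have hsβ : star β ≠ 0 := by simpa using hβ
  have hnorm : ((‖lam‖ ^ 2 : ℝ) : ℂ) = star lam * lam := by
    have := Complex.conj_mul' lam
    simpa using this.symm
  set g : ℂ := (lam - (star lam)⁻¹) / β with hg
  have hgβ : lam - g * β = (star lam)⁻¹ := by rw [hg, div_mul_cancel₀ _ hβ]; ring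
  set c : ℝ := R * (‖lam‖ ^ 2 - 1) / ‖β‖ ^ 2 with hc
  have hc0 : 0 ≤ c := by
    have : 1 ≤ ‖lam‖ ^ 2 := one_le_pow₀ hlam.le
    have := h.pos
    rw [hc]; apply div_nonneg (mul_nonneg _ _) <;> nlinarith [sq_nonneg ‖β‖]
  have hcC : (c : ℂ) = R * (star lam * lam - 1) / (star β * β) := by
    have hnβ : ((‖β‖ ^ 2 : ℝ) : ℂ) = star β * β := by simpa using (Complex.conj_mul' β).symm
    rw [hc, Complex.ofReal_div, Complex.ofReal_mul, Complex.ofReal_sub, hnβ, hnorm]; simp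
  have hsg : star g = (star lam - lam⁻¹) / star β := by
    rw [hg]; simp
  obtain ⟨hX, hopt, hlyap, hgram, hR⟩ := h
  set C := A + B * F with hC
  have hC' : A + B * (F - g • W) = C - g • (B * W) := by
    rw [Matrix.mul_sub, Matrix.mul_smul, hC]; abel
  have hWC : W * (C - g • (B * W)) = (star lam)⁻¹ • W := by
    rw [Matrix.mul_sub, hW, Matrix.mul_smul, ← Matrix.mul_assoc, hWB, Matrix.smul_mul,
      Matrix.one_mul, smul_smul, ← sub_smul, hgβ]
  have hBW : Bᴴ * Wᴴ = star β • 1 := by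
    rw [← Matrix.conjTranspose_mul, hWB]; simp
  have hopt' : Cᴴ * (X * B) = -Fᴴ := by
    rw [← Matrix.conjTranspose_neg, ← hopt]
    simp [Matrix.conjTranspose_mul, hX.isHermitian.eq, Matrix.mul_assoc]
  have hWWC : (Wᴴ * W) * (C - g • (B * W)) = (star lam)⁻¹ • (Wᴴ * W) := by
    rw [Matrix.mul_assoc, hWC, Matrix.mul_smul]
  refine ⟨X + (c : ℂ) • (Wᴴ * W), F - g • W, ⟨?_, ?_, ?_, ?_, ?_⟩, ?_⟩
  · refine hX.add ((Matrix.posSemidef_conjTranspose_mul_self W).smul ?_)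
    exact_mod_cast hc0
  · rw [hC', Matrix.add_mul, Matrix.smul_mul, hWWC, Matrix.mul_sub, Matrix.mul_add,
      Matrix.mul_sub, hopt, Matrix.mul_smul, Matrix.mul_smul, ← Matrix.mul_assoc X,
      ← Matrix.mul_assoc Bᴴ, hgram, Matrix.smul_mul, Matrix.one_mul, Matrix.mul_smul,
      Matrix.mul_smul, ← Matrix.mul_assoc Bᴴ, hBW, Matrix.smul_mul, Matrix.one_mul]
    match_scalars
    · ring
    · rw [hcC, hg]
      field_simp
      ring
  · have e1 : (C - g • (B * W))ᴴ * (X * (C - g • (B * W))) =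
        Cᴴ * (X * C) + g • (Fᴴ * W) + star g • (Wᴴ * F) +
          (star g * g * ((R : ℂ) - 1)) • (Wᴴ * W) := by
      rw [Matrix.conjTranspose_sub, Matrix.conjTranspose_smul, Matrix.conjTranspose_mul,
        Matrix.sub_mul, Matrix.mul_sub, Matrix.mul_sub, Matrix.mul_sub, Matrix.mul_smul,
        Matrix.mul_smul, ← Matrix.mul_assoc X B, ← Matrix.mul_assoc Cᴴ (X * B), hopt',
        Matrix.smul_mul, Matrix.mul_assoc Wᴴ, hopt, Matrix.smul_mul, Matrix.mul_smul,
        Matrix.mul_assoc Wᴴ Bᴴ, ← Matrix.mul_assoc Bᴴ (X * B), hgram]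
      simp only [Matrix.neg_mul, Matrix.mul_neg, Matrix.smul_mul, Matrix.mul_smul, Matrix.one_mul]
      module
    have e2 : (F - g • W)ᴴ * (F - g • W) =
        Fᴴ * F - g • (Fᴴ * W) - star g • (Wᴴ * F) + (star g * g) • (Wᴴ * W) := by
      rw [Matrix.conjTranspose_sub, Matrix.conjTranspose_smul,
        Matrix.sub_mul, Matrix.mul_sub, Matrix.mul_sub]
      simp only [Matrix.smul_mul, Matrix.mul_smul]
      module
    have e3 : (C - g • (B * W))ᴴ * (Wᴴ * W) = lam⁻¹ • (Wᴴ * W) := by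
      rw [← Matrix.mul_assoc, ← Matrix.conjTranspose_mul, hWC]
      simp
    have e4 : (R : ℂ) * (star g * g) + c * (star lam * lam)⁻¹ = c := by
      rw [hcC, hsg, hg]
      field_simp
      ring
    rw [hC', Matrix.add_mul, Matrix.mul_add, e1, e2, Matrix.smul_mul, hWWC, Matrix.mul_smul,
      Matrix.mul_smul, e3]
    calc _ = (Cᴴ * (X * C) + Fᴴ * F) +
          ((R : ℂ) * (star g * g) + c * (star lam * lam)⁻¹) • (Wᴴ * W) := by
            rw [mul_inv]; module
      _ = _ := by rw [hlyap, e4]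
  · rw [Matrix.add_mul, Matrix.mul_add, hgram, Matrix.smul_mul, Matrix.mul_smul, Matrix.mul_assoc,
      hWB, ← Matrix.mul_assoc, hBW, Complex.ofReal_mul, hnorm, hcC]
    simp only [Matrix.smul_mul, Matrix.mul_smul, Matrix.one_mul]
    match_scalars
    field_simp
    ring
  · positivity
  · rw [hC', charpoly_sub_mul_leftEigenvector hW hWB, hgβ]

/-- Reflecting all unstable eigenvalues one after another. -/
theorem IsEnergyFeedback.exists_stable {n : ℕ} {A : Matrix (Fin n) (Fin n) ℂ}
    {B : Matrix (Fin n) (Fin 1) ℂ}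
    (hAB : ∀ (W : Matrix (Fin 1) (Fin n) ℂ) (lam : ℂ), W * A = lam • W → W * B = 0 → W = 0)
    (m : ℕ) : ∀ (X : Matrix (Fin n) (Fin n) ℂ) (F : Matrix (Fin 1) (Fin n) ℂ) (R : ℝ),
      IsEnergyFeedback A B X F R → (∀ z ∈ (A + B * F).charpoly.roots, ‖z‖ ≠ 1) →
      ((A + B * F).charpoly.roots.filter (fun z => 1 < ‖z‖)).card = m →
      ∃ X' F', IsEnergyFeedback A B X' F'
          (R * ((A + B * F).charpoly.roots.map (fun z => max 1 (‖z‖ ^ 2))).prod) ∧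
        ∀ z ∈ (A + B * F').charpoly.roots, ‖z‖ < 1 := by
  induction m with
  | zero =>
    intro X F R h h1 hm
    have hle : ∀ z ∈ (A + B * F).charpoly.roots, ‖z‖ ≤ 1 := by
      intro z hz
      rw [Multiset.card_eq_zero, Multiset.filter_eq_nil] at hm
      exact not_lt.1 (hm z hz)
    have hprod : ((A + B * F).charpoly.roots.map (fun z => max 1 (‖z‖ ^ 2))).prod = 1 := by
      refine Multiset.prod_eq_one fun x hx => ?_
      obtain ⟨z, hz, rfl⟩ := Multiset.mem_map.1 hx
      exact max_eq_left (pow_le_one₀ (norm_nonneg _) (hle z hz))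
    exact ⟨X, F, by rwa [hprod, mul_one], fun z hz => lt_of_le_of_ne (hle z hz) (h1 z hz)⟩
  | succ m ih =>
    intro X F R h h1 hm
    obtain ⟨lam, hlam⟩ := Multiset.card_pos_iff_exists_mem.1 (by rw [hm]; exact m.succ_pos)
    rw [Multiset.mem_filter] at hlam
    obtain ⟨hroot, hgt⟩ := hlam
    have hdet : (Matrix.scalar (Fin n) lam - (A + B * F)).det = 0 := by
      rw [← Matrix.eval_charpoly]
      exact (Polynomial.mem_roots'.1 hroot).2
    obtain ⟨v, hv0, hv⟩ := Matrix.exists_vecMul_eq_zero_iff.2 hdet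
    set W : Matrix (Fin 1) (Fin n) ℂ := Matrix.replicateRow (Fin 1) v with hWdef
    have hW0 : W ≠ 0 := by
      intro h0
      apply hv0
      ext i
      simpa [hWdef] using congrFun (congrFun h0 0) i
    have hW : W * (A + B * F) = lam • W := by
      have h2 : W * (Matrix.scalar (Fin n) lam - (A + B * F)) = 0 := by
        rw [hWdef, ← Matrix.replicateRow_vecMul, hv]; ext; simp
      rw [Matrix.mul_sub, sub_eq_zero] at h2
      rw [← h2]
      ext; simp [mul_comm]
    have hWB : W * B = ((W * B) 0 0) • 1 := by
      ext i j
      fin_cases i; fin_cases j; simp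
    have hβ : (W * B) 0 0 ≠ 0 := by
      intro h0
      rw [h0, zero_smul] at hWB
      refine hW0 (hAB W lam ?_ hWB)
      rw [← hW, Matrix.mul_add, ← Matrix.mul_assoc, hWB]
      simp
    obtain ⟨X₁, F₁, hXF, hχ⟩ := h.reflect hgt hβ hW hWB
    obtain ⟨s, hs⟩ := Multiset.exists_cons_of_mem hroot
    have hroots : (A + B * F₁).charpoly.roots = (star lam)⁻¹ ::ₘ s := by
      have h2 := congrArg Polynomial.roots hχ
      rw [Polynomial.roots_mul (mul_ne_zero (Polynomial.X_sub_C_ne_zero _)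
          (Matrix.charpoly_monic _).ne_zero),
        Polynomial.roots_mul (mul_ne_zero (Polynomial.X_sub_C_ne_zero _)
          (Matrix.charpoly_monic _).ne_zero), Polynomial.roots_X_sub_C, Polynomial.roots_X_sub_C,
        hs, Multiset.singleton_add, Multiset.singleton_add, Multiset.cons_swap] at h2
      exact (Multiset.cons_inj_right _).1 h2
    have hν : ‖(star lam)⁻¹‖ < 1 := by
      rw [norm_inv, norm_star]
      exact inv_lt_one_of_one_lt₀ hgt
    obtain ⟨X₂, F₂, hXF₂, hst⟩ := ih X₁ F₁ _ hXF (by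
        intro z hz
        rw [hroots, Multiset.mem_cons] at hz
        rcases hz with rfl | hz
        · exact hν.ne
        · exact h1 z (by rw [hs]; exact Multiset.mem_cons_of_mem hz)) (by
        rw [hs, Multiset.filter_cons_of_pos (p := fun z : ℂ => 1 < ‖z‖) _ hgt,
          Multiset.card_cons] at hm
        rw [hroots, Multiset.filter_cons_of_neg (p := fun z : ℂ => 1 < ‖z‖) _ (not_lt.2 hν.le)]
        omega)
    refine ⟨X₂, F₂, ?_, hst⟩
    convert hXF₂ using 1
    rw [hs, hroots, Multiset.map_cons, Multiset.prod_cons, Multiset.map_cons, Multiset.prod_cons,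
      max_eq_right (one_le_pow₀ hgt.le), max_eq_left (pow_le_one₀ (norm_nonneg _) hν.le)]
    ring

/-- A stabilizing minimum-energy feedback is unique: the difference `D` of two value matrices
satisfies `D = C₁* D C₂` with both closed loops `C₁`, `C₂` stable. -/
theorem IsEnergyFeedback.unique {n : ℕ} {A : Matrix (Fin n) (Fin n) ℂ}
    {B : Matrix (Fin n) (Fin 1) ℂ} {X₁ X₂ : Matrix (Fin n) (Fin n) ℂ}
    {F₁ F₂ : Matrix (Fin 1) (Fin n) ℂ} {R₁ R₂ : ℝ} (h₁ : IsEnergyFeedback A B X₁ F₁ R₁)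
    (h₂ : IsEnergyFeedback A B X₂ F₂ R₂)
    (hs₁ : Tendsto (fun k : ℕ => (A + B * F₁) ^ k) atTop (𝓝 0))
    (hs₂ : Tendsto (fun k : ℕ => (A + B * F₂) ^ k) atTop (𝓝 0)) : X₁ = X₂ ∧ F₁ = F₂ := by
  set C₁ := A + B * F₁ with hC₁
  set C₂ := A + B * F₂ with hC₂
  have e₁ : C₁ᴴ * (X₁ * C₂) = X₁ - F₁ᴴ * F₂ := by
    have : C₂ = C₁ + B * (F₂ - F₁) := by rw [hC₁, hC₂, Matrix.mul_sub]; abel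
    have hopt' : C₁ᴴ * (X₁ * B) = -F₁ᴴ := by
      rw [← Matrix.conjTranspose_neg, ← h₁.optimal]
      simp [Matrix.conjTranspose_mul, h₁.posSemidef.isHermitian.eq, Matrix.mul_assoc, hC₁]
    rw [this, Matrix.mul_add, Matrix.mul_add, ← Matrix.mul_assoc X₁, ← Matrix.mul_assoc C₁ᴴ (X₁ * B),
      hopt', Matrix.mul_sub, eq_sub_of_add_eq h₁.lyapunov, Matrix.neg_mul, Matrix.neg_mul]
    abel
  have e₂ : C₁ᴴ * (X₂ * C₂) = X₂ - F₁ᴴ * F₂ := by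
    have : C₁ᴴ = C₂ᴴ + (F₁ᴴ - F₂ᴴ) * Bᴴ := by
      rw [← Matrix.conjTranspose_sub, ← Matrix.conjTranspose_mul, ← Matrix.conjTranspose_add,
        hC₁, hC₂, Matrix.mul_sub]
      congr 1; abel
    rw [this, Matrix.add_mul, Matrix.mul_assoc, h₂.optimal, hC₂, eq_sub_of_add_eq h₂.lyapunov,
      Matrix.mul_neg, Matrix.sub_mul]
    abel
  have hD : C₁ᴴ * ((X₁ - X₂) * C₂) = X₁ - X₂ := by
    rw [Matrix.sub_mul, Matrix.mul_sub, e₁, e₂]; abel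
  have hDk : ∀ k : ℕ, (C₁ ^ k)ᴴ * ((X₁ - X₂) * C₂ ^ k) = X₁ - X₂ := by
    intro k
    induction k with
    | zero => simp
    | succ k ih =>
      calc (C₁ ^ (k + 1))ᴴ * ((X₁ - X₂) * C₂ ^ (k + 1))
          = (C₁ ^ k)ᴴ * ((C₁ᴴ * ((X₁ - X₂) * C₂)) * C₂ ^ k) := by
            rw [pow_succ', pow_succ', Matrix.conjTranspose_mul]
            simp only [Matrix.mul_assoc]
        _ = _ := by rw [hD, ih]
  have hlim : Tendsto (fun k : ℕ => (C₁ ^ k)ᴴ * ((X₁ - X₂) * C₂ ^ k)) atTop (𝓝 0) := by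
    have hc : Continuous fun p : Matrix (Fin n) (Fin n) ℂ × Matrix (Fin n) (Fin n) ℂ =>
        p.1ᴴ * ((X₁ - X₂) * p.2) := by fun_prop
    have := (hc.tendsto (0, 0)).comp (hs₁.prodMk_nhds hs₂)
    simpa only [Function.comp_def, Matrix.conjTranspose_zero, Matrix.zero_mul] using this
  have hX : X₁ = X₂ := by
    simp only [hDk] at hlim
    exact sub_eq_zero.1 (tendsto_nhds_unique tendsto_const_nhds hlim)
  refine ⟨hX, ?_⟩
  have h3 : Bᴴ * (X₁ * (B * (F₁ - F₂))) = -(F₁ - F₂) := by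
    have : B * (F₁ - F₂) = C₁ - C₂ := by rw [hC₁, hC₂, Matrix.mul_sub]; abel
    rw [this, Matrix.mul_sub, Matrix.mul_sub, h₁.optimal, hX, h₂.optimal]; abel
  rw [← Matrix.mul_assoc X₁, ← Matrix.mul_assoc, h₁.gram, Matrix.smul_mul, Matrix.one_mul] at h3
  have h4 : (R₁ : ℂ) • (F₁ - F₂) = 0 := by
    rw [sub_smul, one_smul, sub_eq_iff_eq_add] at h3
    rw [h3]; abel
  have h5 : (R₁ : ℂ) ≠ 0 := by exact_mod_cast h₁.pos.ne'
  exact sub_eq_zero.1 ((smul_eq_zero.1 h4).resolve_left h5)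

end Deflation

/-! ### Controllability of matrix pairs -/

section Controllability

/-- Controllability means that the rows of the matrix `[B, A B, …]` are linearly independent. -/
theorem LIMAS.controllable_iff {n m : ℕ} {A : Matrix (Fin n) (Fin n) ℝ}
    {B : Matrix (Fin n) (Fin m) ℝ} :
    LIMAS.Controllable A B ↔
      ∀ v : Fin n → ℝ, (∀ k : Fin n, v ᵥ* (A ^ (k : ℕ) * B) = 0) → v = 0 := by
  set O := Matrix.of fun (i : Fin n) (p : Fin n × Fin m) => (A ^ (p.1 : ℕ) * B) i p.2 with hO
  have h1 : LIMAS.Controllable A B ↔ LinearMap.ker Oᵀ.mulVecLin = ⊥ := by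
    have h2 := LinearMap.finrank_range_add_finrank_ker Oᵀ.mulVecLin
    have h3 : Module.finrank ℝ (LinearMap.range Oᵀ.mulVecLin) = O.rank := by
      rw [← Matrix.rank_transpose]; rfl
    rw [h3, Module.finrank_fin_fun] at h2
    rw [← Submodule.finrank_eq_zero (R := ℝ)]
    change O.rank = n ↔ _
    omega
  rw [h1, LinearMap.ker_eq_bot']
  refine forall_congr' fun v => imp_congr_left ?_
  rw [Matrix.mulVecLin_apply, Matrix.mulVec_transpose]
  constructor
  · intro h k
    ext j
    exact congrFun h (k, j)
  · intro h
    ext ⟨k, j⟩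
    exact congrFun (h k) j

theorem LIMAS.Controllable.smul {n m : ℕ} {A : Matrix (Fin n) (Fin n) ℝ}
    {B : Matrix (Fin n) (Fin m) ℝ} (h : LIMAS.Controllable A B) {c : ℝ} (hc : c ≠ 0) :
    LIMAS.Controllable (c • A) B := by
  rw [LIMAS.controllable_iff] at h ⊢
  refine fun v hv => h v fun k => ?_
  have := hv k
  rw [smul_pow, Matrix.smul_mul, Matrix.vecMul_smul] at this
  exact (smul_eq_zero.1 this).resolve_left (pow_ne_zero _ hc)

theorem LIMAS.Controllable.ne_zero {n m : ℕ} {A : Matrix (Fin n) (Fin n) ℝ}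
    {B : Matrix (Fin n) (Fin m) ℝ} (h : LIMAS.Controllable A B) (hn : n ≠ 0) : B ≠ 0 := by
  rintro rfl
  have := LIMAS.controllable_iff.1 h (fun _ => 1) (by simp)
  simpa using congrFun this ⟨0, Nat.pos_of_ne_zero hn⟩

/-- The Popov–Belevitch–Hautus condition: no left eigenvector of `A`, real or complex, is
annihilated by `B`. -/
theorem LIMAS.Controllable.eq_zero_of_leftEigenvector {n m : ℕ} {A : Matrix (Fin n) (Fin n) ℝ}
    {B : Matrix (Fin n) (Fin m) ℝ} (h : LIMAS.Controllable A B) {W : Matrix (Fin 1) (Fin n) ℂ}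
    {lam : ℂ} (hA : W * A.map (algebraMap ℝ ℂ) = lam • W) (hB : W * B.map (algebraMap ℝ ℂ) = 0) :
    W = 0 := by
  rw [LIMAS.controllable_iff] at h
  have hk : ∀ k : ℕ, W * (A ^ k * B).map (algebraMap ℝ ℂ) = 0 := by
    intro k
    have : W * (A ^ k).map (algebraMap ℝ ℂ) = lam ^ k • W := by
      induction k with
      | zero => simp
      | succ k ih =>
        rw [pow_succ, Matrix.map_mul, ← Matrix.mul_assoc, ih, Matrix.smul_mul, hA, smul_smul,
          pow_succ]
    rw [Matrix.map_mul, ← Matrix.mul_assoc, this, Matrix.smul_mul, hB, smul_zero]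
  have hre := h (fun i => (W 0 i).re) fun k => by
    ext j
    have := congrArg Complex.re (congrFun (congrFun (hk k) 0) j)
    simpa [Matrix.mul_apply (M := W), Matrix.vecMul, dotProduct, -Matrix.map_mul] using this
  have him := h (fun i => (W 0 i).im) fun k => by
    ext j
    have := congrArg Complex.im (congrFun (congrFun (hk k) 0) j)
    simpa [Matrix.mul_apply (M := W), Matrix.vecMul, dotProduct, -Matrix.map_mul] using this
  ext i j
  fin_cases i
  exact Complex.ext (congrFun hre j) (congrFun him j)

end Controllability

/-! ### Solvability of the modified Riccati inequality -/

section Riccati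

theorem charpoly_roots_smul {n : ℕ} (M : Matrix (Fin n) (Fin n) ℂ) {r : ℂ} (hr : r ≠ 0) :
    (r • M).charpoly.roots = M.charpoly.roots.map (fun z => r * z) := by
  have h : (r • M).charpoly.comp (Polynomial.C r * Polynomial.X + Polynomial.C 0) =
      Polynomial.C (r ^ n) * M.charpoly := by
    refine Polynomial.funext fun z => ?_
    have : Matrix.scalar (Fin n) (r * z) - r • M = r • (Matrix.scalar (Fin n) z - M) := by
      rw [smul_sub]; congr 1; ext i j
      simp [Matrix.diagonal_apply]
    simp only [Polynomial.eval_comp, Polynomial.eval_add, Polynomial.eval_mul, Polynomial.eval_C,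
      Polynomial.eval_X, add_zero, Matrix.eval_charpoly]
    rw [this, Matrix.det_smul, Fintype.card_fin]
  rw [← Polynomial.map_roots_comp_C_mul_X_add_C _ r 0 (isUnit_iff_ne_zero.2 hr), h,
    Polynomial.roots_C_mul _ (pow_ne_zero _ hr)]
  simp

theorem Multiset.prod_filter_one_le_norm_sq (s : Multiset ℂ) :
    ((s.filter (fun z => 1 ≤ ‖z‖)).map (fun z => ‖z‖ ^ 2)).prod =
      (s.map (fun z => max 1 (‖z‖ ^ 2))).prod := by
  induction s using Multiset.induction_on with
  | empty => simp
  | cons z s ih =>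
    by_cases hz : 1 ≤ ‖z‖
    · rw [Multiset.filter_cons_of_pos (p := fun z : ℂ => 1 ≤ ‖z‖) _ hz, Multiset.map_cons,
        Multiset.prod_cons, Multiset.map_cons, Multiset.prod_cons, ih,
        max_eq_right (one_le_pow₀ hz)]
    · rw [Multiset.filter_cons_of_neg (p := fun z : ℂ => 1 ≤ ‖z‖) _ hz, Multiset.map_cons,
        Multiset.prod_cons, ih, max_eq_left (pow_le_one₀ (norm_nonneg _) (not_le.1 hz).le), one_mul]

theorem one_le_prod_max_one (s : Multiset ℂ) : 1 ≤ (s.map (fun z => max 1 (‖z‖ ^ 2))).prod := by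
  induction s using Multiset.induction_on with
  | empty => simp
  | cons z s ih =>
    rw [Multiset.map_cons, Multiset.prod_cons]
    exact one_le_mul_of_one_le_of_one_le (le_max_left _ _) ih

theorem LIMAS.schurStable_iff {n : ℕ} {M : Matrix (Fin n) (Fin n) ℝ} :
    LIMAS.SchurStable M ↔ ∀ z ∈ (M.map (algebraMap ℝ ℂ)).charpoly.roots, ‖z‖ < 1 := by
  refine forall_congr' fun z => imp_congr_left ?_
  rw [Matrix.mem_spectrum_iff_isRoot_charpoly,
    Polynomial.mem_roots (Matrix.charpoly_monic _).ne_zero]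

/-- The real form of the minimum-energy feedback. The complex one is real because its entrywise
conjugate is a stabilizing minimum-energy feedback as well. -/
theorem exists_real_energyFeedback {n : ℕ} {A : Matrix (Fin n) (Fin n) ℝ}
    {B : Matrix (Fin n) (Fin 1) ℝ} (hAB : LIMAS.Controllable A B)
    (hA : ∀ z ∈ (A.map (algebraMap ℝ ℂ)).charpoly.roots, ‖z‖ ≠ 1) :
    ∃ (X : Matrix (Fin n) (Fin n) ℝ) (F : Matrix (Fin 1) (Fin n) ℝ),
      X.PosSemidef ∧ (A + B * F)ᵀ * (X * (A + B * F)) + Fᵀ * F = X ∧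
      Bᵀ * (X * B) = (((A.map (algebraMap ℝ ℂ)).charpoly.roots.map
        (fun z => max 1 (‖z‖ ^ 2))).prod - 1) • 1 ∧ LIMAS.SchurStable (A + B * F) := by
  open scoped ComplexOrder in
  set Ac := A.map (algebraMap ℝ ℂ) with hAc
  set Bc := B.map (algebraMap ℝ ℂ) with hBc
  obtain ⟨X, F, hXF, hst⟩ := IsEnergyFeedback.exists_stable (A := Ac) (B := Bc)
    (fun W lam h1 h2 => hAB.eq_zero_of_leftEigenvector h1 h2) _ 0 0 1
    (isEnergyFeedback_zero _ _) (by simpa using hA) rfl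
  simp only [Matrix.mul_zero, add_zero, one_mul] at hXF
  set R := (Ac.charpoly.roots.map (fun z => max 1 (‖z‖ ^ 2))).prod with hR
  have hcj : ∀ {p q : ℕ} (M : Matrix (Fin p) (Fin q) ℂ),
      (M.map (starRingEnd ℂ))ᴴ = Mᴴ.map (starRingEnd ℂ) := fun M => by ext; simp
  have hAcj : Ac.map (starRingEnd ℂ) = Ac := by ext; simp [hAc]
  have hBcj : Bc.map (starRingEnd ℂ) = Bc := by ext; simp [hBc]
  have hadd : ∀ {p q : ℕ} (M N : Matrix (Fin p) (Fin q) ℂ),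
      (M + N).map (starRingEnd ℂ) = M.map (starRingEnd ℂ) + N.map (starRingEnd ℂ) :=
    fun M N => Matrix.map_add _ (map_add _) M N
  have hC : Ac + Bc * F.map (starRingEnd ℂ) = (Ac + Bc * F).map (starRingEnd ℂ) := by
    rw [hadd, Matrix.map_mul, hAcj, hBcj]
  have hXF' : IsEnergyFeedback Ac Bc (X.map (starRingEnd ℂ)) (F.map (starRingEnd ℂ)) R := by
    refine ⟨?_, ?_, ?_, ?_, hXF.pos⟩
    · have : X.map (starRingEnd ℂ) = Xᵀ := by
        ext i j
        exact hXF.posSemidef.isHermitian.apply j i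
      rw [this]
      exact hXF.posSemidef.transpose
    · rw [hC, ← Matrix.map_mul, ← hBcj, hcj, ← Matrix.map_mul, hBcj, hXF.optimal]
      ext; simp
    · rw [hC, hcj, hcj, ← Matrix.map_mul, ← Matrix.map_mul, ← Matrix.map_mul, ← hadd,
        hXF.lyapunov]
    · rw [← hBcj, ← Matrix.map_mul, hcj, ← Matrix.map_mul, hXF.gram]
      ext i j
      fin_cases i; fin_cases j; simp
  have hpow : Tendsto (fun k : ℕ => (Ac + Bc * F) ^ k) atTop (𝓝 0) := by
    refine tendsto_pow_zero_of_spectrum _ fun z hz => hst z ?_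
    rwa [Matrix.mem_spectrum_iff_isRoot_charpoly,
      ← Polynomial.mem_roots (Matrix.charpoly_monic _).ne_zero] at hz
  have hpow' : Tendsto (fun k : ℕ => (Ac + Bc * F.map (starRingEnd ℂ)) ^ k) atTop (𝓝 0) := by
    have h1 := ((continuous_id.matrix_map Complex.continuous_conj :
      Continuous fun M : Matrix (Fin n) (Fin n) ℂ => M.map (starRingEnd ℂ)).tendsto 0).comp hpow
    have h2 : (0 : Matrix (Fin n) (Fin n) ℂ).map (starRingEnd ℂ) = 0 := by ext; simp
    simp only [id, h2] at h1
    refine h1.congr fun k => ?_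
    rw [hC]
    exact Matrix.map_pow _ _ _
  obtain ⟨hX, hF⟩ := hXF.unique hXF' hpow hpow'
  have hreal : ∀ {p q : ℕ} (M : Matrix (Fin p) (Fin q) ℂ), M = M.map (starRingEnd ℂ) →
      M = (M.map Complex.re).map (algebraMap ℝ ℂ) := by
    intro p q M hM
    ext i j
    have h1 : M i j = starRingEnd ℂ (M i j) := congrFun (congrFun hM i) j
    exact (Complex.conj_eq_iff_re.1 h1.symm).symm
  have hXr := hreal X hX
  have hFr := hreal F hF
  set Xr := X.map Complex.re
  set Fr := F.map Complex.re
  have hinj : ∀ {p q : ℕ} {M N : Matrix (Fin p) (Fin q) ℝ},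
      M.map (algebraMap ℝ ℂ) = N.map (algebraMap ℝ ℂ) → M = N := fun h =>
    Matrix.map_injective (algebraMap ℝ ℂ).injective h
  have hct : ∀ {p q : ℕ} (M : Matrix (Fin p) (Fin q) ℝ),
      (M.map (algebraMap ℝ ℂ))ᴴ = Mᵀ.map (algebraMap ℝ ℂ) := fun M => by ext; simp
  have hadd' : ∀ {p q : ℕ} (M N : Matrix (Fin p) (Fin q) ℝ),
      (M + N).map (algebraMap ℝ ℂ) = M.map (algebraMap ℝ ℂ) + N.map (algebraMap ℝ ℂ) :=
    fun M N => Matrix.map_add _ (map_add _) M N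
  have hCr : Ac + Bc * F = (A + B * Fr).map (algebraMap ℝ ℂ) := by
    rw [hadd', Matrix.map_mul, ← hFr]
  refine ⟨Xr, Fr, ?_, hinj ?_, hinj ?_, ?_⟩
  · refine Matrix.PosSemidef.of_dotProduct_mulVec_nonneg ?_ fun v => ?_
    · refine hinj ?_
      rw [conjTranspose_eq_transpose_of_trivial, ← hct, ← hXr]
      exact hXF.posSemidef.isHermitian
    · have h1 := hXF.posSemidef.dotProduct_mulVec_nonneg (fun i => (v i : ℂ))
      rw [hXr] at h1
      have h2 : star (fun i => (v i : ℂ)) ⬝ᵥ Xr.map (algebraMap ℝ ℂ) *ᵥ (fun i => (v i : ℂ)) =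
          ((star v ⬝ᵥ Xr *ᵥ v : ℝ) : ℂ) := by
        simp [dotProduct, Matrix.mulVec]
      simp only [h2] at h1
      exact_mod_cast h1
  · rw [hadd', Matrix.map_mul, Matrix.map_mul, Matrix.map_mul, ← hct, ← hct, ← hCr, ← hXr, ← hFr,
      hXF.lyapunov]
  · rw [Matrix.map_mul, Matrix.map_mul, ← hct, ← hXr, hXF.gram]
    ext i j
    fin_cases i; fin_cases j; simp
  · rw [LIMAS.schurStable_iff, ← hCr]
    exact hst

theorem Matrix.PosDef.gram_pos {n : ℕ} {P : Matrix (Fin n) (Fin n) ℝ} (hP : P.PosDef)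
    {B : Matrix (Fin n) (Fin 1) ℝ} (hB : B ≠ 0) : 0 < (Bᵀ * P * B) 0 0 := by
  have h0 : B.col 0 ≠ 0 := by
    intro h
    apply hB
    ext i j
    fin_cases j
    exact congrFun h i
  have := hP.dotProduct_mulVec_pos h0
  rw [Matrix.dotProduct_mulVec] at this
  exact this

theorem Matrix.eq_smul_one_of_fin_one (M : Matrix (Fin 1) (Fin 1) ℝ) : M = (M 0 0) • 1 := by
  ext i j
  fin_cases i; fin_cases j; simp

/-- The quadratic term of the modified Riccati inequality for a single input, where `Bᵀ P B` is a
number. -/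
theorem riccatiTerm_eq {n : ℕ} {P M : Matrix (Fin n) (Fin n) ℝ} (hP : P.PosDef)
    {B : Matrix (Fin n) (Fin 1) ℝ} (hB : B ≠ 0) :
    Mᵀ * P * B * (Bᵀ * P * B)⁻¹ * Bᵀ * P * M =
      ((Bᵀ * P * B) 0 0)⁻¹ • ((Bᵀ * P * M)ᵀ * (Bᵀ * P * M)) := by
  have hs := (hP.gram_pos hB).ne'
  have h1 : (Bᵀ * P * B)⁻¹ = ((Bᵀ * P * B) 0 0)⁻¹ • 1 := by
    refine Matrix.inv_eq_left_inv ?_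
    rw [Matrix.smul_mul, Matrix.one_mul]
    conv_lhs => rw [Matrix.eq_smul_one_of_fin_one (Bᵀ * P * B)]
    ext i j
    fin_cases i; fin_cases j; simp [hs]
  have hPt : Pᵀ = P := by simpa using hP.isHermitian.eq
  rw [h1]
  simp [Matrix.mul_assoc, Matrix.transpose_mul, hPt]

/-- A feedback `F` with strictly decreasing cost `P` and input energy certifies the modified Riccati
inequality as soon as `(1 - σ) (1 + Bᵀ P B) ≤ 1`. -/
theorem isMARESolution_of_feedback {n : ℕ} {A P : Matrix (Fin n) (Fin n) ℝ}
    {B : Matrix (Fin n) (Fin 1) ℝ} {F : Matrix (Fin 1) (Fin n) ℝ} {σ : ℝ} (hP : P.PosDef)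
    (hB : B ≠ 0) (hQ : (P - (A + B * F)ᵀ * P * (A + B * F) - Fᵀ * F).PosDef) (hσ : 0 < σ)
    (hs : (1 - σ) * (1 + (Bᵀ * P * B) 0 0) ≤ 1) : LIMAS.IsMARESolution A B σ P := by
  refine ⟨hP, ?_⟩
  have hs0 := hP.gram_pos hB
  have hPt : Pᵀ = P := by simpa using hP.isHermitian.eq
  rw [riccatiTerm_eq hP hB]
  have hBPB := Matrix.eq_smul_one_of_fin_one (Bᵀ * P * B)
  set s := (Bᵀ * P * B) 0 0
  set G := Bᵀ * P * A with hG
  have hGt : Gᵀ = Aᵀ * P * B := by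
    simp [hG, Matrix.transpose_mul, hPt, Matrix.mul_assoc]
  set H := G + (s / σ) • F with hH
  have e1 : (A + B * F)ᵀ * P * (A + B * F) =
      Aᵀ * P * A + Gᵀ * F + Fᵀ * G + s • (Fᵀ * F) := by
    have e2 : Fᵀ * Bᵀ * P * (B * F) = s • (Fᵀ * F) := by
      calc _ = Fᵀ * (Bᵀ * P * B) * F := by simp only [Matrix.mul_assoc]
        _ = _ := by rw [hBPB]; simp
    rw [hGt, hG, Matrix.transpose_add, Matrix.transpose_mul, Matrix.add_mul, Matrix.add_mul,
      Matrix.mul_add, Matrix.mul_add, e2]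
    simp only [Matrix.mul_assoc]
    abel
  have e3 : Hᵀ * H = Gᵀ * G + (s / σ) • (Gᵀ * F) + (s / σ) • (Fᵀ * G)
      + (s / σ) ^ 2 • (Fᵀ * F) := by
    rw [hH, Matrix.transpose_add, Matrix.transpose_smul, Matrix.add_mul, Matrix.mul_add,
      Matrix.mul_add]
    simp only [Matrix.smul_mul, Matrix.mul_smul]
    module
  -- Completing the square in `F`; the remaining coefficient of `Fᵀ F` is where `hs` enters.
  have key : -(Aᵀ * P * A - σ • s⁻¹ • (Gᵀ * G) - P) =
      (P - (A + B * F)ᵀ * P * (A + B * F) - Fᵀ * F) + (σ / s) • (Hᵀ * H)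
        + (1 + s - s / σ) • (Fᵀ * F) := by
    rw [e1, e3]
    match_scalars <;> field_simp <;> ring
  rw [key]
  refine (hQ.add_posSemidef (Matrix.PosSemidef.smul ?_ (by positivity))).add_posSemidef
    (Matrix.PosSemidef.smul ?_ ?_)
  · simpa using Matrix.posSemidef_conjTranspose_mul_self H
  · simpa using Matrix.posSemidef_conjTranspose_mul_self F
  · have : s ≤ (1 + s) * σ := by linarith
    have := (div_le_iff₀ hσ).2 this
    linarith

/-- Solving the inequality for the expanded matrix `r A` leaves room for eigenvalues of `A` on the
unit circle. -/
theorem LIMAS.IsMARESolution.of_smul {n : ℕ} {A P : Matrix (Fin n) (Fin n) ℝ}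
    {B : Matrix (Fin n) (Fin 1) ℝ} {σ r : ℝ} (hr : 1 ≤ r)
    (h : LIMAS.IsMARESolution (r • A) B σ P) : LIMAS.IsMARESolution A B σ P := by
  refine ⟨h.1, ?_⟩
  have hr0 : r ≠ 0 := by positivity
  set T := Aᵀ * P * A - σ • (Aᵀ * P * B * (Bᵀ * P * B)⁻¹ * Bᵀ * P * A) with hT
  have h1 : (r • A)ᵀ * P * (r • A) -
      σ • ((r • A)ᵀ * P * B * (Bᵀ * P * B)⁻¹ * Bᵀ * P * (r • A)) = r ^ 2 • T := by
    rw [hT, Matrix.transpose_smul]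
    simp only [Matrix.smul_mul, Matrix.mul_smul]
    module
  have h2 := h.2
  rw [h1] at h2
  have h3 : -(T - P) = (r ^ 2)⁻¹ • -(r ^ 2 • T - P) + (1 - (r ^ 2)⁻¹) • P := by
    match_scalars <;> field_simp
    ring
  rw [h3]
  refine (h2.smul (by positivity)).add_posSemidef (h.1.posSemidef.smul ?_)
  have : (r ^ 2)⁻¹ ≤ 1 := inv_le_one_of_one_le₀ (one_le_pow₀ hr)
  linarith

/-- The critical value: the modified Riccati inequality is solvable for every `σ > σ_c`. -/
theorem LIMAS.Controllable.exists_isMARESolution {n : ℕ} {A : Matrix (Fin n) (Fin n) ℝ}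
    {B : Matrix (Fin n) (Fin 1) ℝ} (hAB : LIMAS.Controllable A B) (hB : B ≠ 0) {σ : ℝ}
    (hσ : LIMAS.sigmaC A < σ) : ∃ P, LIMAS.IsMARESolution A B σ P := by
  set roots := (A.map (algebraMap ℝ ℂ)).charpoly.roots with hroots
  set prod : ℝ → ℝ := fun r => (roots.map (fun z => max 1 ((r * ‖z‖) ^ 2))).prod with hprod
  have hσ' : 1 - 1 / prod 1 < σ := by
    have : LIMAS.sigmaC A = 1 - 1 / prod 1 := by
      rw [LIMAS.sigmaC, Multiset.prod_filter_one_le_norm_sq]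
      simp [hprod, hroots]
    rwa [← this]
  have hp1 : 1 ≤ prod 1 := by
    have := one_le_prod_max_one roots
    simpa [hprod] using this
  have hσ0 : 0 < σ := by
    have : 1 / prod 1 ≤ 1 := (div_le_one (by linarith)).2 hp1
    linarith
  have hlt : (1 - σ) * prod 1 < 1 := by
    have h1 : 1 - σ < 1 / prod 1 := by linarith
    exact (lt_div_iff₀ (by linarith)).1 h1
  have hcont : Continuous prod := by
    refine continuous_multiset_prod roots fun z _ => ?_
    fun_prop
  have hev1 : ∀ᶠ r in 𝓝[>] (1 : ℝ), (1 - σ) * prod r < 1 :=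
    (((continuous_const.mul hcont).tendsto 1).eventually_lt_const hlt).filter_mono
      nhdsWithin_le_nhds
  have hev2 : ∀ᶠ r in 𝓝[>] (1 : ℝ), ∀ z ∈ roots.toFinset, r * ‖z‖ ≠ 1 := by
    rw [Filter.eventually_all_finset]
    intro z _
    rcases lt_or_ge ‖z‖ 1 with hz | hz
    · have : Tendsto (fun r : ℝ => r * ‖z‖) (𝓝 1) (𝓝 (1 * ‖z‖)) :=
        tendsto_id.mul_const _
      rw [one_mul] at this
      exact ((this.eventually_lt_const hz).filter_mono nhdsWithin_le_nhds).mono fun r hr => hr.ne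
    · filter_upwards [self_mem_nhdsWithin] with r hr
      have hr1 : 1 < r := hr
      nlinarith
  -- A slight expansion `r A` has no eigenvalue on the unit circle and keeps `(1 - σ) ∏ < 1`.
  obtain ⟨r, ⟨hr1, hr2⟩, hr⟩ := ((hev1.and hev2).and self_mem_nhdsWithin).exists
  have hr : 1 < r := hr
  have hr0 : (r : ℂ) ≠ 0 := by
    have : r ≠ 0 := by positivity
    exact_mod_cast this
  have hmap : (r • A).map (algebraMap ℝ ℂ) = (r : ℂ) • A.map (algebraMap ℝ ℂ) := by ext; simp
  have hnr : ∀ z : ℂ, ‖(r : ℂ) * z‖ = r * ‖z‖ := fun z => by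
    rw [norm_mul, Complex.norm_real, Real.norm_of_nonneg (by linarith)]
  have hrootsr := charpoly_roots_smul (A.map (algebraMap ℝ ℂ)) hr0
  rw [← hmap, ← hroots] at hrootsr
  obtain ⟨X, F, hX, hlyap, hgram, hst⟩ := exists_real_energyFeedback (hAB.smul (c := r)
    (by positivity)) (by
      intro w hw
      rw [hrootsr] at hw
      obtain ⟨z, hz, rfl⟩ := Multiset.mem_map.1 hw
      rw [hnr]
      exact hr2 z (Multiset.mem_toFinset.2 hz))
  have hpr : (((r • A).map (algebraMap ℝ ℂ)).charpoly.roots.map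
      (fun z => max 1 (‖z‖ ^ 2))).prod = prod r := by
    rw [hrootsr, Multiset.map_map]
    simp only [Function.comp_def, hnr, hprod]
  rw [hpr] at hgram
  obtain ⟨W, hW, hWQ⟩ := hst.exists_lyapunov
  -- `P = X + η W` with `η` small makes the Lyapunov inequality strict and `P` definite.
  obtain ⟨η, hη1, hη⟩ : ∃ η : ℝ, (1 - σ) * (prod r + η * (Bᵀ * W * B) 0 0) < 1 ∧ 0 < η := by
    have hc : Continuous fun η : ℝ => (1 - σ) * (prod r + η * (Bᵀ * W * B) 0 0) := by fun_prop
    have hev : ∀ᶠ η in 𝓝[>] (0 : ℝ), (1 - σ) * (prod r + η * (Bᵀ * W * B) 0 0) < 1 :=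
      ((hc.tendsto 0).eventually_lt_const (by simpa using hr1)).filter_mono nhdsWithin_le_nhds
    exact (hev.and self_mem_nhdsWithin).exists
  set C := r • A + B * F
  refine ⟨X + η • W, LIMAS.IsMARESolution.of_smul hr.le (isMARESolution_of_feedback (F := F)
    (Matrix.PosDef.posSemidef_add hX (hW.smul hη)) hB ?_ hσ0 ?_)⟩
  · have : X + η • W - Cᵀ * (X + η • W) * C - Fᵀ * F =
        η • (W - Cᵀ * W * C) := by
      rw [Matrix.mul_add Cᵀ X, Matrix.add_mul (Cᵀ * X), Matrix.mul_smul, Matrix.smul_mul, smul_sub,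
        Matrix.mul_assoc _ X, eq_sub_of_add_eq hlyap]
      abel
    rw [this]
    exact hWQ.smul hη
  · have h1 : (Bᵀ * (X + η • W) * B) 0 0 = prod r - 1 + η * (Bᵀ * W * B) 0 0 := by
      rw [Matrix.mul_add, Matrix.add_mul, Matrix.mul_smul, Matrix.smul_mul, Matrix.mul_assoc _ X,
        hgram]
      simp
    rw [h1]
    have : 1 + (prod r - 1 + η * (Bᵀ * W * B) 0 0) = prod r + η * (Bᵀ * W * B) 0 0 := by ring
    rw [this]
    exact hη1.le

end Riccati

/-! ### Weighted Laplacians and network modes -/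

section Laplacian

namespace LIMAS

variable {N : ℕ}

theorem WeightedGraph.laplacian_isHermitian (G : WeightedGraph N) : G.laplacian.IsHermitian := by
  ext i j
  by_cases h : i = j
  · subst h; simp
  · simp [laplacian, Matrix.diagonal_apply_ne _ h, Matrix.diagonal_apply_ne' _ h, G.symm i j]

theorem WeightedGraph.laplacian_mulVec (G : WeightedGraph N) (v : Fin N → ℝ) (i : Fin N) :
    (G.laplacian *ᵥ v) i = ∑ j, G.weight i j * (v i - v j) := by
  simp only [laplacian, Matrix.sub_mulVec, Pi.sub_apply, Matrix.mulVec_diagonal, mul_sub,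
    Finset.sum_sub_distrib, Finset.sum_mul]
  rfl

/-- Summation by parts, from the symmetry of the Laplacian. -/
theorem WeightedGraph.sum_smul_sum_weight {E : Type*} [AddCommGroup E] [Module ℝ E]
    (G : WeightedGraph N) (v : Fin N → ℝ) (x : Fin N → E) :
    ∑ i, v i • ∑ j, G.weight i j • (x i - x j) = ∑ i, (G.laplacian *ᵥ v) i • x i := by
  simp only [G.laplacian_mulVec, Finset.smul_sum, Finset.sum_smul, smul_sub, mul_sub, sub_smul,
    Finset.sum_sub_distrib, smul_smul]
  congr 1
  · exact Finset.sum_congr rfl fun i _ => Finset.sum_congr rfl fun j _ => by rw [mul_comm]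
  · rw [Finset.sum_comm]
    exact Finset.sum_congr rfl fun i _ => Finset.sum_congr rfl fun j _ => by
      rw [mul_comm, G.symm]

theorem WeightedGraph.sum_laplacian_mulVec (G : WeightedGraph N) (v : Fin N → ℝ) :
    ∑ i, (G.laplacian *ᵥ v) i = 0 := by
  have := G.sum_smul_sum_weight v (fun _ => (1 : ℝ))
  simpa using this.symm

theorem WeightedGraph.two_mul_dotProduct_laplacian (G : WeightedGraph N) (v : Fin N → ℝ) :
    2 * (v ⬝ᵥ G.laplacian *ᵥ v) = ∑ i, ∑ j, G.weight i j * (v i - v j) ^ 2 := by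
  have h1 : v ⬝ᵥ G.laplacian *ᵥ v = ∑ i, ∑ j, G.weight i j * (v i * (v i - v j)) := by
    simp only [dotProduct, G.laplacian_mulVec, Finset.mul_sum]
    exact Finset.sum_congr rfl fun i _ => Finset.sum_congr rfl fun j _ => by ring
  have h2 : v ⬝ᵥ G.laplacian *ᵥ v = ∑ i, ∑ j, G.weight i j * (v j * (v j - v i)) := by
    rw [h1, Finset.sum_comm]
    exact Finset.sum_congr rfl fun i _ => Finset.sum_congr rfl fun j _ => by rw [G.symm]
  rw [two_mul]
  nth_rewrite 1 [h1]
  rw [h2, ← Finset.sum_add_distrib]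
  refine Finset.sum_congr rfl fun i _ => ?_
  rw [← Finset.sum_add_distrib]
  exact Finset.sum_congr rfl fun j _ => by ring

theorem WeightedGraph.eq_of_laplacian_mulVec_eq_zero {G : WeightedGraph N}
    (hG : G.graph.Connected) {v : Fin N → ℝ} (hv : G.laplacian *ᵥ v = 0) (i j : Fin N) :
    v i = v j := by
  have h0 := G.two_mul_dotProduct_laplacian v
  rw [hv, dotProduct_zero, mul_zero] at h0
  have hnn : ∀ i j, 0 ≤ G.weight i j * (v i - v j) ^ 2 :=
    fun i j => mul_nonneg (G.nonneg i j) (sq_nonneg _)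
  have hadj : ∀ i j, G.graph.Adj i j → v i = v j := by
    intro i j hij
    have h1 := (Finset.sum_eq_zero_iff_of_nonneg fun i _ => Finset.sum_nonneg fun j _ => hnn i j).1
      h0.symm i (Finset.mem_univ i)
    have h2 := (Finset.sum_eq_zero_iff_of_nonneg fun j _ => hnn i j).1 h1 j (Finset.mem_univ j)
    have h3 : 0 < G.weight i j := hij
    have h4 := (mul_eq_zero.1 h2).resolve_left h3.ne'
    exact sub_eq_zero.1 (pow_eq_zero_iff two_ne_zero |>.1 h4)
  obtain ⟨p⟩ := hG.preconnected i j
  induction p with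
  | nil => rfl
  | cons h _ ih => exact (hadj _ _ h).trans ih

theorem reducedEigenvalues_finite (L : Matrix (Fin N) (Fin N) ℝ) :
    (reducedEigenvalues L).Finite := by
  refine L.charpoly.roots.toFinset.finite_toSet.subset ?_
  rintro μ ⟨v, hv, -, h⟩
  rw [Finset.mem_coe, Multiset.mem_toFinset, Polynomial.mem_roots (Matrix.charpoly_monic _).ne_zero,
    Polynomial.IsRoot, Matrix.eval_charpoly]
  refine Matrix.exists_mulVec_eq_zero_iff.1 ⟨v, hv, ?_⟩
  rw [Matrix.sub_mulVec, h, sub_eq_zero]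
  ext i
  simp [Matrix.mulVec_diagonal]

theorem WeightedGraph.reducedEigenvalues_pos {G : WeightedGraph N} (hG : G.graph.Connected)
    {μ : ℝ} (hμ : μ ∈ reducedEigenvalues G.laplacian) : 0 < μ := by
  obtain ⟨v, hv, hsum, h⟩ := hμ
  have h1 := G.two_mul_dotProduct_laplacian v
  rw [h, dotProduct_smul, smul_eq_mul] at h1
  have h2 : 0 ≤ ∑ i, ∑ j, G.weight i j * (v i - v j) ^ 2 :=
    Finset.sum_nonneg fun i _ => Finset.sum_nonneg fun j _ =>
      mul_nonneg (G.nonneg i j) (sq_nonneg _)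
  have h3 : 0 < v ⬝ᵥ v := by simpa using dotProduct_star_self_pos_iff.2 hv
  have h4 : 0 ≤ μ := by
    by_contra h5
    nlinarith
  refine lt_of_le_of_ne h4 fun h5 => hv ?_
  rw [← h5, zero_smul] at h
  have hc := G.eq_of_laplacian_mulVec_eq_zero hG h
  ext i
  have h6 : ∑ j, v j = N * v i := by
    rw [Finset.sum_congr rfl fun j _ => hc j i]; simp
  rw [hsum] at h6
  have : (N : ℝ) ≠ 0 := by exact_mod_cast (Fin.pos i).ne'
  exact (mul_eq_zero.1 h6.symm).resolve_left this

/-- The common eigenvectors of two commuting Laplacians span. -/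
theorem eq_top_of_common_eigenvectors {Gp Gc : WeightedGraph N}
    (hcomm : Commute Gp.laplacian Gc.laplacian) (T : Submodule ℝ (Fin N → ℝ))
    (hT : ∀ (v : Fin N → ℝ) (μ l : ℝ), Gp.laplacian *ᵥ v = μ • v → Gc.laplacian *ᵥ v = l • v →
      v ∈ T) : T = ⊤ := by
  have htop := LinearMap.IsSymmetric.iSup_iSup_eigenspace_inf_eigenspace_eq_top_of_commute
    (Matrix.isSymmetric_toEuclideanLin_iff.2 Gp.laplacian_isHermitian)
    (Matrix.isSymmetric_toEuclideanLin_iff.2 Gc.laplacian_isHermitian) (by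
      ext v : 1
      have h := congrArg (fun M => M *ᵥ (WithLp.ofLp v)) hcomm.eq
      simp only [← Matrix.mulVec_mulVec] at h
      simp only [Module.End.mul_apply, Matrix.toLpLin_apply, h])
  set T' := T.comap (WithLp.linearEquiv 2 ℝ (Fin N → ℝ)).toLinearMap with hT'
  have h : (⊤ : Submodule ℝ (EuclideanSpace ℝ (Fin N))) ≤ T' := by
    rw [← htop]
    refine iSup_le fun μ => iSup_le fun l => ?_
    rintro v ⟨h1, h2⟩
    rw [SetLike.mem_coe, Module.End.mem_eigenspace_iff] at h1 h2
    exact hT _ μ l (congrArg WithLp.ofLp h1) (congrArg WithLp.ofLp h2)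
  rw [eq_top_iff]
  intro v _
  exact h (x := WithLp.toLp 2 v) Submodule.mem_top

/-- A common eigenvector is constant or has zero average, since `L_c` is singular on the constant
vectors only. -/
theorem const_or_sum_eq_zero {Gc : WeightedGraph N} (hGc : Gc.graph.Connected) {v : Fin N → ℝ}
    {l : ℝ} (h : Gc.laplacian *ᵥ v = l • v) : (∀ i j, v i = v j) ∨ ∑ i, v i = 0 := by
  rcases eq_or_ne l 0 with rfl | hl
  · rw [zero_smul] at h
    exact Or.inl (Gc.eq_of_laplacian_mulVec_eq_zero hGc h)
  · have := Gc.sum_laplacian_mulVec v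
    rw [h] at this
    simp only [Pi.smul_apply, smul_eq_mul, ← Finset.mul_sum] at this
    exact Or.inr ((mul_eq_zero.1 this).resolve_left hl)

theorem reducedEigenvalues_nonempty (hN : 2 ≤ N) {Gp Gc : WeightedGraph N}
    (hGc : Gc.graph.Connected) (hcomm : Commute Gp.laplacian Gc.laplacian) :
    (reducedEigenvalues Gp.laplacian).Nonempty ∧ (reducedEigenvalues Gc.laplacian).Nonempty := by
  by_contra hne
  have htop := eq_top_of_common_eigenvectors hcomm (Submodule.span ℝ {fun _ => (1 : ℝ)}) (by
    intro v μ l h1 h2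
    rw [Submodule.mem_span_singleton]
    rcases const_or_sum_eq_zero hGc h2 with hc | hs
    · exact ⟨v ⟨0, by omega⟩, by ext i; simpa using hc _ _⟩
    · by_cases hv : v = 0
      · exact ⟨0, by rw [hv, zero_smul]⟩
      · exact absurd ⟨⟨μ, v, hv, hs, h1⟩, ⟨l, v, hv, hs, h2⟩⟩ hne)
  have hmem : Pi.single (⟨0, by omega⟩ : Fin N) (1 : ℝ) ∈
      Submodule.span ℝ {fun _ : Fin N => (1 : ℝ)} := htop ▸ Submodule.mem_top
  obtain ⟨c, hc⟩ := Submodule.mem_span_singleton.1 hmem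
  have h0 := congrFun hc ⟨0, by omega⟩
  have h1 := congrFun hc ⟨1, by omega⟩
  simp at h0 h1
  rw [h0] at h1
  exact one_ne_zero h1

/-- A common eigenvector of the Laplacians turns the network into a single closed loop. -/
theorem IsTrajectory.mode {n : ℕ} {Gp Gc : WeightedGraph N} {A Ap : Matrix (Fin n) (Fin n) ℝ}
    {B : Matrix (Fin n) (Fin 1) ℝ} {K : Matrix (Fin 1) (Fin n) ℝ} {x : ℕ → Fin N → Fin n → ℝ}
    (hx : IsTrajectory Gp Gc A Ap B K x) {v : Fin N → ℝ} {μ l : ℝ}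
    (hp : Gp.laplacian *ᵥ v = μ • v) (hc : Gc.laplacian *ᵥ v = l • v) (t : ℕ) :
    ∑ i, v i • x (t + 1) i = (A - μ • Ap + l • (B * K)) *ᵥ ∑ i, v i • x t i := by
  have hneg : ∀ i, ∑ j, Gp.weight i j • (x t j - x t i) =
      -∑ j, Gp.weight i j • (x t i - x t j) := fun i => by
    rw [← Finset.sum_neg_distrib]
    exact Finset.sum_congr rfl fun j _ => by rw [← smul_neg, neg_sub]
  have hlin : ∀ (M : Matrix (Fin n) (Fin n) ℝ) (y : Fin N → Fin n → ℝ),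
      ∑ i, v i • (M *ᵥ y i) = M *ᵥ ∑ i, v i • y i := fun M y => by
    rw [← Matrix.mulVecLin_apply, map_sum]
    exact Finset.sum_congr rfl fun i _ => by rw [map_smul, Matrix.mulVecLin_apply]
  have hp' := Gp.sum_smul_sum_weight v (x t)
  have hc' := Gc.sum_smul_sum_weight v (x t)
  have he : ∀ c : ℝ, ∑ i, (c • v) i • x t i = c • ∑ i, v i • x t i := fun c => by
    rw [Finset.smul_sum]
    exact Finset.sum_congr rfl fun i _ => by rw [Pi.smul_apply, smul_assoc]
  rw [hp, he] at hp'
  rw [hc, he] at hc'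
  simp only [hx t, hneg, Matrix.mulVec_neg, Matrix.mulVec_mulVec, smul_add, smul_neg,
    Finset.sum_add_distrib, Finset.sum_neg_distrib, hlin, hp', hc']
  simp only [Matrix.add_mulVec, Matrix.sub_mulVec, Matrix.smul_mulVec, Matrix.mulVec_smul]
  abel

/-- Consensus follows once every closed loop belonging to eigenvalues of the two Laplacians on the
zero-average space is stable. The vectors `v` whose zero-average part has a mode tending to zero
form a subspace, which contains all common eigenvectors and hence everything. -/
theorem achievesConsensus_of_modes (hN : 2 ≤ N) {n : ℕ} {Gp Gc : WeightedGraph N}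
    (hGc : Gc.graph.Connected) (hcomm : Commute Gp.laplacian Gc.laplacian)
    {A Ap : Matrix (Fin n) (Fin n) ℝ} {B : Matrix (Fin n) (Fin 1) ℝ}
    {K : Matrix (Fin 1) (Fin n) ℝ}
    (h : ∀ μ ∈ reducedEigenvalues Gp.laplacian, ∀ l ∈ reducedEigenvalues Gc.laplacian,
      ∀ z : ℕ → Fin n → ℝ, (∀ t, z (t + 1) = (A - μ • Ap + l • (B * K)) *ᵥ z t) →
        Tendsto z atTop (𝓝 0)) :
    AchievesConsensus Gp Gc A Ap B K := by
  intro x hx i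
  have hN0 : (N : ℝ) ≠ 0 := by positivity
  let T : Submodule ℝ (Fin N → ℝ) :=
    { carrier := {v | Tendsto (fun t => ∑ k, v k • (x t k - average (x t))) atTop (𝓝 0)}
      zero_mem' := by simp
      add_mem' := by
        intro v w hv hw
        simpa [add_smul, Finset.sum_add_distrib] using Tendsto.add hv hw
      smul_mem' := by
        intro c v hv
        simpa [← smul_smul, ← Finset.smul_sum] using Tendsto.const_smul hv c }
  have havg : ∀ t, ∑ k, (x t k - average (x t)) = 0 := fun t => by
    rw [Finset.sum_sub_distrib, average]
    simp [← Nat.cast_smul_eq_nsmul ℝ, smul_smul, hN0]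
  have htop : T = ⊤ := eq_top_of_common_eigenvectors hcomm T fun v μ l hp hc => by
    change Tendsto _ _ _
    rcases const_or_sum_eq_zero hGc hc with hcon | hs
    · refine tendsto_const_nhds.congr fun t => ?_
      rw [Finset.sum_congr rfl fun k _ => by rw [hcon k i], ← Finset.smul_sum, havg, smul_zero]
    · by_cases hv : v = 0
      · simp [hv]
      · have hz := h μ ⟨v, hv, hs, hp⟩ l ⟨v, hv, hs, hc⟩ (fun t => ∑ k, v k • x t k)
          fun t => hx.mode hp hc t
        refine hz.congr fun t => ?_
        simp [smul_sub, Finset.sum_sub_distrib, ← Finset.sum_smul, hs]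
  have hi : Pi.single i (1 : ℝ) ∈ T := htop ▸ Submodule.mem_top
  have hi' : Tendsto (fun t => ∑ k, (Pi.single i (1 : ℝ) : Fin N → ℝ) k •
      (x t k - average (x t))) atTop (𝓝 0) := hi
  simpa [Pi.single_apply] using hi'

end LIMAS

end Laplacian

/-! ### Consensus by a common Lyapunov matrix -/

section Consensus

namespace LIMAS

/-- A solution of the modified Riccati inequality for `m A` is a common Lyapunov matrix for all
closed loops `a A - c B (Bᵀ P B)⁻¹ Bᵀ P A` with `|a| ≤ m` and `σ m² ≤ 2 a c - c²`. -/
theorem IsMARESolution.lyapunov {n : ℕ} {A P : Matrix (Fin n) (Fin n) ℝ}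
    {B : Matrix (Fin n) (Fin 1) ℝ} {σ m a c : ℝ} (h : IsMARESolution (m • A) B σ P) (hB : B ≠ 0)
    (ham : |a| ≤ m) (hσ : σ * m ^ 2 ≤ 2 * a * c - c ^ 2) {M : Matrix (Fin n) (Fin n) ℝ}
    (hM : M = a • A - c • (B * ((Bᵀ * P * B)⁻¹ * Bᵀ * P * A))) :
    (P - Mᵀ * P * M).PosDef := by
  obtain ⟨hP, hQ⟩ := h
  rw [riccatiTerm_eq hP hB] at hQ
  have hs0 := hP.gram_pos hB
  have hPt : Pᵀ = P := by simpa using hP.isHermitian.eq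
  have hBPB := Matrix.eq_smul_one_of_fin_one (Bᵀ * P * B)
  set s := (Bᵀ * P * B) 0 0
  set G := Bᵀ * P * A with hG
  have hGt : Gᵀ = Aᵀ * P * B := by simp [hG, Matrix.transpose_mul, hPt, Matrix.mul_assoc]
  have hinv : (Bᵀ * P * B)⁻¹ = s⁻¹ • 1 := by
    refine Matrix.inv_eq_left_inv ?_
    rw [hBPB, Matrix.smul_mul, Matrix.one_mul, smul_smul, inv_mul_cancel₀ hs0.ne', one_smul]
  have hM' : M = a • A - (c / s) • (B * G) := by
    rw [hM, hinv, hG]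
    simp only [Matrix.smul_mul, Matrix.mul_smul, Matrix.one_mul, smul_smul, Matrix.mul_assoc,
      div_eq_mul_inv]
  have e0 : Gᵀ * Bᵀ * P * (B * G) = s • (Gᵀ * G) := by
    calc _ = Gᵀ * (Bᵀ * P * B) * G := by simp only [Matrix.mul_assoc]
      _ = _ := by rw [hBPB]; simp
  have e1 : Aᵀ * P * (B * G) = Gᵀ * G := by rw [← Matrix.mul_assoc, ← hGt]
  have e2 : Gᵀ * Bᵀ * P * A = Gᵀ * G := by rw [hG]; simp only [Matrix.mul_assoc]
  have e3 : Mᵀ * P * M = a ^ 2 • (Aᵀ * P * A) - ((2 * a * c - c ^ 2) / s) • (Gᵀ * G) := by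
    rw [hM', Matrix.transpose_sub, Matrix.transpose_smul, Matrix.transpose_smul,
      Matrix.transpose_mul]
    simp only [Matrix.sub_mul, Matrix.mul_sub, Matrix.smul_mul, Matrix.mul_smul]
    rw [e0, e1, e2]
    match_scalars <;> field_simp
    ring
  have e4 : P - Mᵀ * P * M =
      -((m • A)ᵀ * P * (m • A) - σ • s⁻¹ • ((Bᵀ * P * (m • A))ᵀ * (Bᵀ * P * (m • A))) - P)
        + (m ^ 2 - a ^ 2) • (Aᵀ * P * A)
        + ((2 * a * c - c ^ 2 - σ * m ^ 2) / s) • (Gᵀ * G) := by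
    rw [e3, Matrix.mul_smul (Bᵀ * P), ← hG]
    simp only [Matrix.transpose_smul, Matrix.smul_mul, Matrix.mul_smul]
    match_scalars <;> field_simp <;> ring
  rw [e4]
  refine (hQ.add_posSemidef (Matrix.PosSemidef.smul ?_ ?_)).add_posSemidef
    (Matrix.PosSemidef.smul ?_ ?_)
  · simpa using hP.posSemidef.conjTranspose_mul_mul_same A
  · have := sq_abs a
    have := abs_nonneg a
    nlinarith
  · simpa using Matrix.posSemidef_conjTranspose_mul_self G
  · exact div_nonneg (by linarith) hs0.le

/-- With `k` the midpoint of the ratios `a / l`, the identity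
`2 a l k - l² k² = a² - l² (a / l - k)²` bounds the gain margin from below. -/
theorem sub_le_two_mul_sub_sq {a l k d m L : ℝ} (hl : 0 < l) (hlL : l ≤ L) (hm : 0 ≤ m)
    (hma : m ≤ |a|) (hk : |a / l - k| ≤ d) :
    m ^ 2 - L ^ 2 * d ^ 2 ≤ 2 * a * l * k - l ^ 2 * k ^ 2 := by
  have h1 : 2 * a * l * k - l ^ 2 * k ^ 2 = a ^ 2 - l ^ 2 * (a / l - k) ^ 2 := by
    field_simp
    ring
  have h2 : m ^ 2 ≤ a ^ 2 := by rw [← sq_abs a]; exact pow_le_pow_left₀ hm hma 2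
  have h3 : (a / l - k) ^ 2 ≤ d ^ 2 := by
    rw [← sq_abs]; exact pow_le_pow_left₀ (abs_nonneg _) hk 2
  have h4 : l ^ 2 ≤ L ^ 2 := pow_le_pow_left₀ hl.le hlL 2
  have h5 := mul_le_mul h4 h3 (sq_nonneg _) (sq_nonneg _)
  linarith

end LIMAS

end Consensus

theorem mainTheorem5 {N n : ℕ} (hN : 2 ≤ N) (Gp Gc : LIMAS.WeightedGraph N)
    (hGc : Gc.graph.Connected)
    (A Ap : Matrix (Fin n) (Fin n) ℝ) (B : Matrix (Fin n) (Fin 1) ℝ) (α : ℝ)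
    (hcomm : Commute Gp.laplacian Gc.laplacian)
    (hctrl : ∀ μ ∈ LIMAS.reducedEigenvalues Gp.laplacian, LIMAS.Controllable (A - μ • Ap) B)
    (hAp : Ap = α • A) :
    (LIMAS.SchurStable (LIMAS.alphaMax Gp α • A) →
      LIMAS.AchievesConsensus Gp Gc A Ap B 0) ∧
    (¬ LIMAS.SchurStable (LIMAS.alphaMax Gp α • A) →
      ((sSup (LIMAS.ratios Gp Gc α) - sInf (LIMAS.ratios Gp Gc α)) / 2) ^ 2 <
        (LIMAS.alphaMin Gp α ^ 2
            - LIMAS.alphaMax Gp α ^ 2 * LIMAS.sigmaC (LIMAS.alphaMax Gp α • A))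
          / LIMAS.lambdaCMax Gc ^ 2 →
      LIMAS.sigmaC (LIMAS.alphaMax Gp α • A) < LIMAS.sigmaStar Gp Gc α ∧
      (∃ P : Matrix (Fin n) (Fin n) ℝ,
        LIMAS.IsMARESolution (LIMAS.alphaMax Gp α • A) B (LIMAS.sigmaStar Gp Gc α) P) ∧
      ∀ P : Matrix (Fin n) (Fin n) ℝ,
        LIMAS.IsMARESolution (LIMAS.alphaMax Gp α • A) B (LIMAS.sigmaStar Gp Gc α) P →
        LIMAS.AchievesConsensus Gp Gc A Ap B
          (-(LIMAS.kStar Gp Gc α) • ((Bᵀ * P * B)⁻¹ * Bᵀ * P * A))) := by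
  subst hAp
  obtain ⟨hpne, hcne⟩ := LIMAS.reducedEigenvalues_nonempty hN hGc hcomm
  have hpfin := LIMAS.reducedEigenvalues_finite Gp.laplacian
  have hcfin := LIMAS.reducedEigenvalues_finite Gc.laplacian
  have hafin : (LIMAS.alphas Gp α).Finite := hpfin.image _
  have hane : (LIMAS.alphas Gp α).Nonempty := hpne.image _
  have hmem : ∀ μ ∈ LIMAS.reducedEigenvalues Gp.laplacian, 1 - α * μ ∈ LIMAS.alphas Gp α :=
    fun μ hμ => ⟨μ, hμ, rfl⟩
  have hle : ∀ a ∈ LIMAS.alphas Gp α, |a| ≤ LIMAS.alphaMax Gp α := fun a ha =>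
    le_csSup (hafin.image _).bddAbove ⟨a, ha, rfl⟩
  have hloop : ∀ μ : ℝ, A - μ • α • A = (1 - α * μ) • A := fun μ => by
    rw [smul_smul, sub_smul, one_smul, mul_comm]
  constructor
  · intro hst
    refine LIMAS.achievesConsensus_of_modes hN hGc hcomm fun μ hμ l _ z hz => ?_
    have hst' := LIMAS.SchurStable.smul_of_abs_le (hle _ (hmem μ hμ)) hst
    have hz' : ∀ t, z t = ((1 - α * μ) • A) ^ t *ᵥ z 0 := by
      intro t
      induction t with
      | zero => simp
      | succ t ih =>
        rw [hz, ih, hloop, Matrix.mulVec_mulVec, Matrix.mul_zero, smul_zero, add_zero, pow_succ']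
    have hc : Continuous fun M : Matrix (Fin n) (Fin n) ℝ => M *ᵥ z 0 := by fun_prop
    have := (hc.tendsto 0).comp hst'.tendsto_pow
    rw [Matrix.zero_mulVec] at this
    exact this.congr fun t => (hz' t).symm
  intro hst hcond
  set amax := LIMAS.alphaMax Gp α with hamax
  set k := LIMAS.kStar Gp Gc α with hk
  set σ := LIMAS.sigmaStar Gp Gc α with hσdef
  set rmax := sSup (LIMAS.ratios Gp Gc α) with hrmax
  set rmin := sInf (LIMAS.ratios Gp Gc α) with hrmin
  have hkr : k = (rmin + rmax) / 2 := rfl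
  have hamax0 : 0 < amax := by
    obtain ⟨a, ha⟩ := hane
    refine lt_of_le_of_ne ((abs_nonneg a).trans (hle a ha)) fun h0 => hst ?_
    rw [← h0, zero_smul]
    exact LIMAS.SchurStable.zero
  have hn : n ≠ 0 := by
    rintro rfl
    apply hst
    rw [Subsingleton.elim (amax • A) 0]
    exact LIMAS.SchurStable.zero
  -- The index attaining `α_max` transfers controllability to `(α_max A, B)`.
  have hctrl' : LIMAS.Controllable (amax • A) B := by
    obtain ⟨a, ha, haeq⟩ : amax ∈ (fun a => |a|) '' LIMAS.alphas Gp α :=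
      (hane.image _).csSup_mem (hafin.image _)
    obtain ⟨μ, hμ, rfl⟩ := ha
    have h1 := hctrl μ hμ
    have ha0 : 1 - α * μ ≠ 0 := by
      intro h0
      simp only [h0, abs_zero] at haeq
      exact hamax0.ne haeq
    rw [hloop] at h1
    have h2 := h1.smul (c := amax / (1 - α * μ)) (div_ne_zero hamax0.ne' ha0)
    rwa [smul_smul, div_mul_cancel₀ _ ha0] at h2
  have hB := hctrl'.ne_zero hn
  have hlpos : ∀ l ∈ LIMAS.reducedEigenvalues Gc.laplacian, 0 < l := fun l hl =>
    Gc.reducedEigenvalues_pos hGc hl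
  have hlmax : ∀ l ∈ LIMAS.reducedEigenvalues Gc.laplacian, l ≤ LIMAS.lambdaCMax Gc := fun l hl =>
    le_csSup hcfin.bddAbove hl
  have hLpos : 0 < LIMAS.lambdaCMax Gc := by
    obtain ⟨l, hl⟩ := hcne
    exact (hlpos l hl).trans_le (hlmax l hl)
  have hrfin : (LIMAS.ratios Gp Gc α).Finite := hafin.image2 _ hcfin
  have hgain : ∀ a ∈ LIMAS.alphas Gp α, ∀ l ∈ LIMAS.reducedEigenvalues Gc.laplacian,
      amax ^ 2 * LIMAS.sigmaC (amax • A) < 2 * a * l * k - l ^ 2 * k ^ 2 := by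
    intro a ha l hl
    have hmin : LIMAS.alphaMin Gp α ≤ |a| := csInf_le (hafin.image _).bddBelow ⟨a, ha, rfl⟩
    have hmin0 : 0 ≤ LIMAS.alphaMin Gp α := by
      refine Real.sInf_nonneg ?_
      rintro _ ⟨b, _, rfl⟩
      exact abs_nonneg b
    have hr : a / l ∈ LIMAS.ratios Gp Gc α := ⟨a, ha, l, hl, rfl⟩
    have hr1 := le_csSup hrfin.bddAbove hr
    have hr2 := csInf_le hrfin.bddBelow hr
    have hd : |a / l - k| ≤ (rmax - rmin) / 2 := by
      rw [abs_le, hkr]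
      constructor <;> linarith
    have h1 := LIMAS.sub_le_two_mul_sub_sq (hlpos l hl) (hlmax l hl) hmin0 hmin hd
    rw [lt_div_iff₀ (by positivity)] at hcond
    linarith
  have hSfin : (Set.image2 (fun a l => (2 * a * l * k - l ^ 2 * k ^ 2) / amax ^ 2)
      (LIMAS.alphas Gp α) (LIMAS.reducedEigenvalues Gc.laplacian)).Finite := hafin.image2 _ hcfin
  have hσ : LIMAS.sigmaC (amax • A) < σ := by
    obtain ⟨a, ha, l, hl, h⟩ : σ ∈ Set.image2
        (fun a l => (2 * a * l * k - l ^ 2 * k ^ 2) / amax ^ 2) (LIMAS.alphas Gp α)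
        (LIMAS.reducedEigenvalues Gc.laplacian) := (hane.image2 hcne).csInf_mem hSfin
    rw [← h, lt_div_iff₀ (by positivity), mul_comm]
    exact hgain a ha l hl
  refine ⟨hσ, hctrl'.exists_isMARESolution hB hσ, fun P hP => ?_⟩
  refine LIMAS.achievesConsensus_of_modes hN hGc hcomm fun μ hμ l hl z hz => ?_
  have hσle : σ * amax ^ 2 ≤ 2 * (1 - α * μ) * (l * k) - (l * k) ^ 2 := by
    have h1 : σ ≤ (2 * (1 - α * μ) * l * k - l ^ 2 * k ^ 2) / amax ^ 2 :=
      csInf_le hSfin.bddBelow ⟨_, hmem μ hμ, l, hl, rfl⟩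
    rw [le_div_iff₀ (by positivity)] at h1
    linarith
  refine tendsto_zero_of_lyapunov hP.1
    (hP.lyapunov hB (hle _ (hmem μ hμ)) hσle (M := A - μ • α • A +
      l • (B * (-k • ((Bᵀ * P * B)⁻¹ * Bᵀ * P * A)))) ?_) hz
  rw [hloop, Matrix.mul_smul]
  module
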